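/- All graphs are finite and simple; $v(G)$ and $e(G)$ denote the numbers of vertices and edges of $G$. A graph $G$ is $4$-critical if its chromatic number is $4$ and every proper subgraph of $G$ is $3$-colourable. A $(7,2)$-circular-colouring of $G$ is a map $f : V(G) \to \{0,1,\dots,6\}$ such that $2 \le |f(u)-f(v)| \le 5$ for every edge $uv$ of $G$. Let $W_6$ be the wheel on six vertices, that is, a $5$-cycle together with one further vertex adjacent to all vertices of the cycle. Theorem. Let $G$ be a $4$-critical graph that has no $(7,2)$-circular-colouring and is isomorphic neither to $K_4$ nor to $W_6$. Then $$e(G) \ge \frac{17\,v(G)}{10}.$$ -/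

import Mathlib

/-- A graph is `k`-critical if its chromatic number is `k` and every proper subgraph
(on possibly fewer vertices, not necessarily induced) is `(k - 1)`-colourable. -/
def SimpleGraph.IsKCritical {V : Type*} (G : SimpleGraph V) (k : ℕ) : Prop :=
  G.chromaticNumber = (k : ℕ∞) ∧ ∀ H : G.Subgraph, H ≠ ⊤ → H.coe.Colorable (k - 1)

/-- The circular clique `G_{p,q}`: the vertices are `0, …, p - 1`, and `i`, `j` are adjacent when
`q ≤ |i - j| ≤ p - q`. The condition `i ≠ j` is automatic for `q ≥ 1`. -/
def circularClique (p q : ℕ) : SimpleGraph (Fin p) where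
  Adj i j := i ≠ j ∧ (q : ℤ) ≤ |(i : ℤ) - (j : ℤ)| ∧ |(i : ℤ) - (j : ℤ)| ≤ (p : ℤ) - (q : ℤ)
  symm := ⟨fun i j h => ⟨h.1.symm, by rw [abs_sub_comm]; exact h.2.1,
    by rw [abs_sub_comm]; exact h.2.2⟩⟩
  loopless := ⟨fun _ h => h.1 rfl⟩

/-- A `(p,q)`-circular-colouring is a homomorphism to the circular clique `G_{p,q}`. -/
def SimpleGraph.CircularColorable {V : Type*} (G : SimpleGraph V) (p q : ℕ) : Prop :=
  Nonempty (G →g circularClique p q)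

/-- The wheel `W_n` on `n` vertices (for `n ≥ 4`): a cycle on `n - 1` vertices together with
a hub (`none`) adjacent to all vertices of the cycle. -/
def wheelGraph (n : ℕ) : SimpleGraph (Option (Fin (n - 1))) where
  Adj
    | none, none => False
    | none, some _ => True
    | some _, none => True
    | some i, some j => (SimpleGraph.cycleGraph (n - 1)).Adj i j
  symm := ⟨by
    rintro (_ | i) (_ | j) h
    · exact h
    · trivial
    · trivial
    · exact SimpleGraph.Adj.symm h⟩
  loopless := ⟨by
    rintro (_ | i) h
    · exact h
    · exact SimpleGraph.irrefl _ h⟩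

/-! Delete a few adjacent vertices of degree three. Criticality 3-colours the rest, and failure to
extend the colouring fixes the pattern of colours on the outer neighbours. Read as 0, 2, 4 modulo 7,
the three colours leave slack between 4 and 0: any vertices may move from 4 to 5 or from 0 to 6,
provided no edge joins a vertex moved to 5 and one moved to 6 (`homOff_shiftColor`). The moved
colouring would extend to K_{7/2} unless certain outer neighbours coincide or are adjacent; this
gives `EdgeCritical.eq_of_triangle`, `EdgeCritical.adj_of_edge` and `EdgeCritical.center_structure`.

The bound is proved by induction on edges for minimal non-3-colourable graphs, counting nonisolated
vertices only, with error terms 8 and 2 that are exact for K_4 and W_6. An induced path of three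
vertices of degree three is contracted to one vertex (`contractPath`), which keeps both kinds of
non-colourability and removes two vertices and four edges. If the result is critical, induction
applies. Otherwise only `wp` or `wq` can be superfluous, where `w` is the third neighbour of the
middle vertex: either `w` has degree three and becomes isolated, and induction again suffices, or
the degrees of `w` and of one of `p`, `q` are large (`IsCenter.edgeBound_or`).

If this last case holds around every such path, discharging finishes: vertices of degree at least 4
share their excess over 17/5 among their neighbours of degree three, and a transfer of 1/20 between
adjacent vertices of degree three settles the tight case (`EdgeCritical.bound_of_centerCondition`).
-/

namespace SimpleGraph
-- Finite checks on three colours and on K_{7/2}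
section FiniteChecks

set_option synthInstance.maxSize 2000
set_option synthInstance.maxHeartbeats 200000

/-- Boolean form of adjacency in the circular clique `K_{7/2}`. -/
def circAdj (i j : Fin 7) : Bool :=
  2 ≤ (i - j).val && (i - j).val ≤ 5

lemma circAdj_iff (i j : Fin 7) : circAdj i j = true ↔ (circularClique 7 2).Adj i j := by
  change circAdj i j = true ↔ (i ≠ j ∧ (2 : ℤ) ≤ |(i : ℤ) - (j : ℤ)| ∧ |(i : ℤ) - (j : ℤ)| ≤ (7 : ℤ) - (2 : ℤ))
  revert i j
  decide

/-- Undoes the contraction of a path: `v` is the colour of the contracted vertex, `a` the new colour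
of the middle vertex, and the two `b` are the colours of the ends. -/
lemma exists_circAdj_path : ∀ v p : Fin 7, circAdj v p → ∀ q, circAdj v q → ∀ x, circAdj v x →
    ∀ w, ∃ a, circAdj a w ∧ (∃ b, circAdj b p ∧ circAdj b x ∧ circAdj b a) ∧
      ∃ b, circAdj b q ∧ circAdj b x ∧ circAdj b a := by
  decide +kernel

/-- As for the path, but `w` is uncoloured too and has remaining neighbours `p` and `q`; the first
`b` is its colour. -/
lemma exists_circAdj_claw : ∀ v p : Fin 7, circAdj v p → ∀ q, circAdj v q → ∀ x, circAdj v x →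
    ∃ a, (∃ b, circAdj b p ∧ circAdj b q ∧ circAdj b a) ∧
      (∃ b, circAdj b p ∧ circAdj b x ∧ circAdj b a) ∧
      ∃ b, circAdj b q ∧ circAdj b x ∧ circAdj b a := by
  decide +kernel

lemma exists_two_others : ∀ γ : Fin 3, ∃ α β, α ≠ β ∧ γ ≠ α ∧ γ ≠ β := by decide

lemma triangle_extension_fin_three : ∀ a b c : Fin 3, ¬ (a = b ∧ a = c) →
    ∃ i j k : Fin 3, i ≠ a ∧ j ≠ b ∧ k ≠ c ∧ i ≠ j ∧ i ≠ k ∧ j ≠ k := by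
  decide

lemma edge_extension_fin_three : ∀ a b c d : Fin 3,
    ¬ (∃ i j : Fin 3, i ≠ a ∧ i ≠ b ∧ j ≠ c ∧ j ≠ d ∧ i ≠ j) →
    a ≠ b ∧ (c = a ∧ d = b ∨ d = a ∧ c = b) := by
  decide

/-- A path fails to extend only if each end has a single available colour and these two colours,
with that of `w`, exhaust the palette. So each end sees the colour of `w` and one other, and the
other colours differ. -/
lemma path_extension_fin_three : ∀ s t w s' t' : Fin 3,
    ¬ (∃ i j k : Fin 3, i ≠ s ∧ i ≠ t ∧ k ≠ s' ∧ k ≠ t' ∧ j ≠ w ∧ i ≠ j ∧ k ≠ j) →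
    (t = w ∧ w ≠ s ∨ s = w ∧ w ≠ t) ∧ (t' = w ∧ w ≠ s' ∨ s' = w ∧ w ≠ t') ∧
      (t = w → t' = w → s ≠ s') ∧ (t = w → s' = w → s ≠ t') ∧
      (s = w → t' = w → t ≠ s') ∧ (s = w → s' = w → t ≠ t') := by
  decide +kernel

lemma exists_third : ∀ a b : Fin 3, ∃ c, a ≠ c ∧ b ≠ c := by decide

/-- If `p`, `q`, `x` had three distinct colours, the ends of the path would be forced to the colours
of `q` and `p`, hence the middle `a` to that of `x`, which would be the colour of `w`. -/
lemma not_rainbow_fin_three : ∀ p q x w a : Fin 3, (∃ b, b ≠ p ∧ b ≠ x ∧ b ≠ a) →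
    (∃ c, c ≠ q ∧ c ≠ x ∧ c ≠ a) → a ≠ w → (w = x ∨ w ≠ p ∧ w ≠ q) →
    ∃ d, d ≠ p ∧ d ≠ q ∧ d ≠ x := by
  decide +kernel

/-- Both ends take the common free colour `d`; the middle avoids only `d` and `w`. -/
lemma path_extension_of_common : ∀ p q x w : Fin 3, (∃ d, d ≠ p ∧ d ≠ q ∧ d ≠ x) →
    ∃ i j k : Fin 3, i ≠ p ∧ i ≠ x ∧ k ≠ q ∧ k ≠ x ∧ j ≠ w ∧ i ≠ j ∧ k ≠ j := by
  decide +kernel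

lemma not_wheel_coloring_fin_three : ∀ h a b c d e : Fin 3,
    ¬ ((h ≠ a ∧ h ≠ b ∧ h ≠ c ∧ h ≠ d ∧ h ≠ e) ∧ a ≠ b ∧ b ≠ c ∧ c ≠ d ∧ d ≠ e ∧ e ≠ a) := by
  decide +kernel

end FiniteChecks
end SimpleGraph

namespace SimpleGraph
-- Partial colourings, colour shifts and extensions
section Colorings
open scoped Classical

variable {V C : Type*} {G : SimpleGraph V} {K : SimpleGraph C} {X : Set V} {g : V → C}

/-- `g` respects all edges of `G` that avoid `X`. -/
def HomOff (G : SimpleGraph V) (K : SimpleGraph C) (X : Set V) (g : V → C) : Prop :=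
  ∀ ⦃a b⦄, a ∉ X → b ∉ X → G.Adj a b → K.Adj (g a) (g b)

/-- The neighbours of `u` are the three distinct vertices `a`, `b`, `c`. -/
def HasNbrs (G : SimpleGraph V) (u a b c : V) : Prop :=
  a ≠ b ∧ a ≠ c ∧ b ≠ c ∧ ∀ y, G.Adj u y ↔ y = a ∨ y = b ∨ y = c

/-- Minimal non-3-colourable graphs, where isolated vertices are allowed. -/
def EdgeCritical (G : SimpleGraph V) : Prop :=
  ¬ G.Colorable 3 ∧ ∀ H ≤ G, ¬ H.Colorable 3 → H = G

lemma HasNbrs.swap {u a b c : V} (h : G.HasNbrs u a b c) : G.HasNbrs u a c b :=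
  ⟨h.2.1, h.1, h.2.2.1.symm, fun y => by rw [h.2.2.2]; tauto⟩

lemma HasNbrs.rotate {u a b c : V} (h : G.HasNbrs u a b c) : G.HasNbrs u b c a :=
  ⟨h.2.2.1, h.1.symm, h.2.1.symm, fun y => by rw [h.2.2.2]; tauto⟩

lemma HasNbrs.swap_left {u a b c : V} (h : G.HasNbrs u a b c) : G.HasNbrs u b a c :=
  h.rotate.swap

lemma HasNbrs.adj {u a b c : V} (h : G.HasNbrs u a b c) :
    G.Adj u a ∧ G.Adj u b ∧ G.Adj u c := by
  simp [h.2.2.2]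

lemma HomOff.update {u : V} {c : C} (h : HomOff G K (insert u X) g)
    (hu : ∀ y, G.Adj u y → y ∉ X → K.Adj c (g y)) : HomOff G K X (Function.update g u c) := by
  intro a b ha hb hab
  by_cases hau : a = u
  · subst hau
    rw [Function.update_self, Function.update_of_ne hab.ne']
    exact hu b hab hb
  · by_cases hbu : b = u
    · subst hbu
      rw [Function.update_self, Function.update_of_ne hab.ne]
      exact (hu a hab.symm ha).symm
    · rw [Function.update_of_ne hau, Function.update_of_ne hbu]
      exact h (by simp [hau, ha]) (by simp [hbu, hb]) hab

lemma not_homOff_top (h : ¬ G.Colorable 3) (φ : V → Fin 3) : ¬ HomOff G ⊤ ∅ φ := by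
  intro hφ
  exact h ⟨⟨φ, fun {a b} hab => hφ (by simp) (by simp) hab⟩⟩

lemma not_homOff_circ (h : ¬ G.CircularColorable 7 2) (g : V → Fin 7) :
    ¬ HomOff G (circularClique 7 2) ∅ g := by
  intro hg
  exact h ⟨⟨g, fun {a b} hab => hg (by simp) (by simp) hab⟩⟩

lemma EdgeCritical.exists_homOff (hG : G.EdgeCritical) {a b : V} (hab : G.Adj a b)
    (ha : a ∈ X) : ∃ φ : V → Fin 3, HomOff G ⊤ X φ := by
  let H : SimpleGraph V :=
    { Adj := fun a b => a ∉ X ∧ b ∉ X ∧ G.Adj a b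
      symm := ⟨fun a b h => ⟨h.2.1, h.1, h.2.2.symm⟩⟩
      loopless := ⟨fun a h => h.2.2.ne rfl⟩ }
  have hle : H ≤ G := fun _ _ h => h.2.2
  have hH : H.Colorable 3 := by
    by_contra hH
    have := hG.2 H hle hH
    rw [← this] at hab
    exact hab.1 ha
  obtain ⟨φ⟩ := hH
  exact ⟨φ, fun a b ha hb hab => φ.valid (v := a) (w := b) ⟨ha, hb, hab⟩⟩

lemma EdgeCritical.exists_coloring_delete (hG : G.EdgeCritical) {a b : V} (hab : G.Adj a b) :
    ∃ φ : V → Fin 3, ∀ c d, G.Adj c d → s(c, d) ≠ s(a, b) → φ c ≠ φ d := by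
  have hH : (G.deleteEdges {s(a, b)}).Colorable 3 := by
    by_contra hH
    have := hG.2 _ (G.deleteEdges_le _) hH
    rw [← this] at hab
    simp at hab
  obtain ⟨φ⟩ := hH
  exact ⟨φ, fun c d hcd hne => φ.valid (by simpa using ⟨hcd, by simpa using hne⟩)⟩

/-- Turn a 3-colouring into colours `0`, `2`, `4` of `K_{7/2}`, and move `S` from `0` to `6` and
`T` from `4` to `5`. -/
noncomputable def shiftColor (φ : V → Fin 3) (α β : Fin 3) (S T : Set V) (v : V) : Fin 7 :=
  if φ v = α then (if v ∈ S then 6 else 0)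
  else if φ v = β then 2 else (if v ∈ T then 5 else 4)

lemma eq_of_ne_fin_three : ∀ α β c d : Fin 3, α ≠ β → c ≠ α → c ≠ β → d ≠ α → d ≠ β → c = d := by
  decide

/-- Modulo 7, the values 0 and 6 are compatible with 2 and 4, and 0 is compatible with 5; only the
pair 5, 6 is too close, and `hST` excludes it. -/
lemma homOff_shiftColor {φ : V → Fin 3} (hφ : HomOff G ⊤ X φ) {α β : Fin 3} (hαβ : α ≠ β)
    {S T : Set V} (hST : ∀ a ∈ S, ∀ b ∈ T, ¬ G.Adj a b) :
    HomOff G (circularClique 7 2) X (shiftColor φ α β S T) := by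
  intro a b ha hb hab
  have hne : φ a ≠ φ b := hφ ha hb hab
  rw [← circAdj_iff]
  have key := eq_of_ne_fin_three α β (φ a) (φ b) hαβ
  unfold shiftColor
  split_ifs with h1 h2 h3 h4 h5 h6 h7 h8 h9 <;> first
    | rfl
    | (exfalso; simp_all; done)
    | (exfalso; exact hST _ ‹_› _ ‹_› hab.symm)

lemma HomOff.extend_path {u₁ u₂ u₃ p x w q x' : V} {c₁ c₂ c₃ : C}
    (hg : HomOff G K {u₁, u₂, u₃} g)
    (h1 : G.HasNbrs u₁ u₂ p x) (h3 : G.HasNbrs u₃ u₂ q x') (h2 : G.HasNbrs u₂ u₁ u₃ w)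
    (hn : ¬ G.Adj u₁ u₃) (c1p : K.Adj c₁ (g p)) (c1x : K.Adj c₁ (g x)) (c3q : K.Adj c₃ (g q))
    (c3x : K.Adj c₃ (g x')) (c2w : K.Adj c₂ (g w)) (c12 : K.Adj c₁ c₂) (c32 : K.Adj c₃ c₂) :
    ∃ g', HomOff G K ∅ g' := by
  have e1 : HomOff G K {u₂, u₃} (Function.update g u₁ c₁) := by
    refine hg.update fun y hy hyX => ?_
    rcases (h1.2.2.2 y).1 hy with rfl | rfl | rfl
    · simp at hyX
    · exact c1p
    · exact c1x
  have e2 : HomOff G K {u₃} (Function.update (Function.update g u₁ c₁) u₂ c₂) := by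
    refine e1.update fun y hy hyX => ?_
    rcases (h2.2.2.2 y).1 hy with rfl | rfl | rfl
    · simpa using c12.symm
    · simp at hyX
    · rwa [Function.update_of_ne h2.2.1.symm]
  refine ⟨Function.update (Function.update (Function.update g u₁ c₁) u₂ c₂) u₃ c₃, ?_⟩
  rw [← LawfulSingleton.insert_empty_eq u₃] at e2
  refine e2.update fun y hy hyX => ?_
  have hy1 : y ≠ u₁ := by rintro rfl; exact hn hy.symm
  rcases (h3.2.2.2 y).1 hy with rfl | rfl | rfl
  · simpa using c32
  · rwa [Function.update_of_ne h3.1.symm, Function.update_of_ne hy1]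
  · rwa [Function.update_of_ne h3.2.1.symm, Function.update_of_ne hy1]

lemma HomOff.extend_triangle {u₁ u₂ u₃ z₁ z₂ z₃ : V} {c₁ c₂ c₃ : C}
    (hg : HomOff G K {u₁, u₂, u₃} g)
    (h1 : G.HasNbrs u₁ u₂ u₃ z₁) (h2 : G.HasNbrs u₂ u₁ u₃ z₂) (h3 : G.HasNbrs u₃ u₁ u₂ z₃)
    (c1 : K.Adj c₁ (g z₁)) (c2 : K.Adj c₂ (g z₂)) (c3 : K.Adj c₃ (g z₃))
    (c12 : K.Adj c₁ c₂) (c13 : K.Adj c₁ c₃) (c23 : K.Adj c₂ c₃) :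
    ∃ g', HomOff G K ∅ g' := by
  have e1 : HomOff G K {u₂, u₃} (Function.update g u₁ c₁) := by
    refine hg.update fun y hy hyX => ?_
    rcases (h1.2.2.2 y).1 hy with rfl | rfl | rfl
    · simp at hyX
    · simp at hyX
    · exact c1
  have e2 : HomOff G K {u₃} (Function.update (Function.update g u₁ c₁) u₂ c₂) := by
    refine e1.update fun y hy hyX => ?_
    rcases (h2.2.2.2 y).1 hy with rfl | rfl | rfl
    · simpa using c12.symm
    · simp at hyX
    · rwa [Function.update_of_ne h2.2.1.symm]
  refine ⟨Function.update (Function.update (Function.update g u₁ c₁) u₂ c₂) u₃ c₃, ?_⟩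
  rw [← LawfulSingleton.insert_empty_eq u₃] at e2
  refine e2.update fun y hy hyX => ?_
  rcases (h3.2.2.2 y).1 hy with rfl | rfl | rfl
  · rw [Function.update_of_ne h3.1, Function.update_self]
    exact c13.symm
  · simpa using c23.symm
  · rwa [Function.update_of_ne h3.2.2.1.symm, Function.update_of_ne h3.2.1.symm]

lemma HomOff.extend_edge {u₁ u₂ x₁ y₁ x₂ y₂ : V} {c₁ c₂ : C}
    (hg : HomOff G K {u₁, u₂} g)
    (h1 : G.HasNbrs u₁ u₂ x₁ y₁) (h2 : G.HasNbrs u₂ u₁ x₂ y₂)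
    (c1x : K.Adj c₁ (g x₁)) (c1y : K.Adj c₁ (g y₁)) (c2x : K.Adj c₂ (g x₂))
    (c2y : K.Adj c₂ (g y₂)) (c12 : K.Adj c₁ c₂) : ∃ g', HomOff G K ∅ g' := by
  have e1 : HomOff G K {u₂} (Function.update g u₁ c₁) := by
    refine hg.update fun y hy hyX => ?_
    rcases (h1.2.2.2 y).1 hy with rfl | rfl | rfl
    · simp at hyX
    · exact c1x
    · exact c1y
  refine ⟨Function.update (Function.update g u₁ c₁) u₂ c₂, ?_⟩
  rw [← LawfulSingleton.insert_empty_eq u₂] at e1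
  refine e1.update fun y hy hyX => ?_
  rcases (h2.2.2.2 y).1 hy with rfl | rfl | rfl
  · simpa using c12.symm
  · rwa [Function.update_of_ne h2.1.symm]
  · rwa [Function.update_of_ne h2.2.1.symm]

end Colorings
end SimpleGraph

namespace SimpleGraph
-- Rigidity around adjacent vertices of degree three
section Structure
open scoped Classical

variable {V : Type*} {G : SimpleGraph V} {φ : V → Fin 3} {α β : Fin 3} {S T : Set V} {v : V}

lemma shiftColor_eq_zero (h : φ v = α) (hv : v ∉ S) : shiftColor φ α β S T v = 0 := by
  simp [shiftColor, h, hv]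

lemma shiftColor_eq_six (h : φ v = α) (hv : v ∈ S) : shiftColor φ α β S T v = 6 := by
  simp [shiftColor, h, hv]

lemma shiftColor_eq_two (hαβ : α ≠ β) (h : φ v = β) : shiftColor φ α β S T v = 2 := by
  simp [shiftColor, h, hαβ.symm]

lemma shiftColor_eq_four (hα : φ v ≠ α) (hβ : φ v ≠ β) (hv : v ∉ T) :
    shiftColor φ α β S T v = 4 := by
  simp [shiftColor, hα, hβ, hv]

lemma shiftColor_eq_five (hα : φ v ≠ α) (hβ : φ v ≠ β) (hv : v ∈ T) :
    shiftColor φ α β S T v = 5 := by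
  simp [shiftColor, hα, hβ, hv]

lemma circAdj_of_eq {i j k : Fin 7} (h : j = k) (hik : circAdj i k = true) :
    (circularClique 7 2).Adj i j := by
  subst h
  exact (circAdj_iff _ _).1 hik

/-- Put the common class of the outer neighbours at 4 and move `z₁` alone to 5. The triangle takes
the colours 1, 3, 6: 1 suits both outer values, 3 suits 5, and 6 suits 4. -/
lemma eq_of_triangle_aux (hcol : ¬ G.CircularColorable 7 2) {u₁ u₂ u₃ z₁ z₂ z₃ : V}
    (h1 : G.HasNbrs u₁ u₂ u₃ z₁) (h2 : G.HasNbrs u₂ u₁ u₃ z₂) (h3 : G.HasNbrs u₃ u₁ u₂ z₃)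
    (hφ : HomOff G ⊤ {u₁, u₂, u₃} φ) (h12 : φ z₁ = φ z₂) (h13 : φ z₁ = φ z₃) : z₁ = z₂ := by
  by_contra hz
  obtain ⟨α, β, hαβ, hα, hβ⟩ := exists_two_others (φ z₁)
  have hS := homOff_shiftColor hφ hαβ (S := ∅) (T := {z₁}) (by simp)
  have e1 : shiftColor φ α β ∅ {z₁} z₁ = 5 := shiftColor_eq_five hα hβ rfl
  have e2 : shiftColor φ α β ∅ {z₁} z₂ = 4 :=
    shiftColor_eq_four (h12 ▸ hα) (h12 ▸ hβ) (Ne.symm hz)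
  by_cases h : z₃ = z₁
  · have e3 : shiftColor φ α β ∅ {z₁} z₃ = 5 := by rw [h, e1]
    obtain ⟨g, hg⟩ := hS.extend_triangle (c₁ := 1) (c₂ := 6) (c₃ := 3) h1 h2 h3
      (circAdj_of_eq e1 rfl) (circAdj_of_eq e2 rfl) (circAdj_of_eq e3 rfl)
      (circAdj_of_eq rfl rfl) (circAdj_of_eq rfl rfl) (circAdj_of_eq rfl rfl)
    exact not_homOff_circ hcol g hg
  · have e3 : shiftColor φ α β ∅ {z₁} z₃ = 4 :=
      shiftColor_eq_four (h13 ▸ hα) (h13 ▸ hβ) h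
    obtain ⟨g, hg⟩ := hS.extend_triangle (c₁ := 3) (c₂ := 6) (c₃ := 1) h1 h2 h3
      (circAdj_of_eq e1 rfl) (circAdj_of_eq e2 rfl) (circAdj_of_eq e3 rfl)
      (circAdj_of_eq rfl rfl) (circAdj_of_eq rfl rfl) (circAdj_of_eq rfl rfl)
    exact not_homOff_circ hcol g hg

/-- The outer neighbours of a triangle of vertices of degree three coincide. -/
lemma EdgeCritical.eq_of_triangle (hG : G.EdgeCritical) (hcol : ¬ G.CircularColorable 7 2)
    {u₁ u₂ u₃ z₁ z₂ z₃ : V}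
    (h1 : G.HasNbrs u₁ u₂ u₃ z₁) (h2 : G.HasNbrs u₂ u₁ u₃ z₂) (h3 : G.HasNbrs u₃ u₁ u₂ z₃) :
    z₁ = z₂ ∧ z₁ = z₃ := by
  obtain ⟨φ, hφ⟩ := hG.exists_homOff (X := {u₁, u₂, u₃}) h1.adj.1 (by simp)
  have hcl : φ z₁ = φ z₂ ∧ φ z₁ = φ z₃ := by
    by_contra hne
    obtain ⟨i, j, k, hi, hj, hk, hij, hik, hjk⟩ := triangle_extension_fin_three _ _ _ hne
    obtain ⟨g, hg⟩ := hφ.extend_triangle (c₁ := i) (c₂ := j) (c₃ := k) h1 h2 h3 hi hj hk hij hik hjk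
    exact not_homOff_top hG.1 g hg
  refine ⟨eq_of_triangle_aux hcol h1 h2 h3 hφ hcl.1 hcl.2,
    eq_of_triangle_aux (φ := φ) hcol h1.swap_left h3 h2 ?_ hcl.2 hcl.1⟩
  rwa [Set.pair_comm]

/-- Without these adjacencies `x₁` may move to 5 while `y₁`, `y₂` move to 6. Then 3 is free at `u₁`
and 1 at `u₂`, whether or not `x₂ = x₁`. -/
lemma adj_of_edge_aux (hcol : ¬ G.CircularColorable 7 2) {u₁ u₂ x₁ y₁ x₂ y₂ : V}
    (h1 : G.HasNbrs u₁ u₂ x₁ y₁) (h2 : G.HasNbrs u₂ u₁ x₂ y₂)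
    (hφ : HomOff G ⊤ {u₁, u₂} φ) (hne : φ x₁ ≠ φ y₁) (hx : φ x₂ = φ x₁) (hy : φ y₂ = φ y₁) :
    G.Adj x₁ y₁ ∨ G.Adj x₁ y₂ := by
  by_contra! hadj
  obtain ⟨β, hβ1, hβ2⟩ : ∃ β, φ x₁ ≠ β ∧ φ y₁ ≠ β := by
    exact exists_third _ _
  have hS := homOff_shiftColor hφ hβ2 (S := {y₁, y₂}) (T := {x₁}) (by
    rintro a (rfl | rfl) b rfl
    · exact fun h => hadj.1 h.symm
    · exact fun h => hadj.2 h.symm)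
  set c := shiftColor φ (φ y₁) β {y₁, y₂} {x₁} with hc
  have ex1 : c x₁ = 5 := shiftColor_eq_five hne hβ1 rfl
  have ey1 : c y₁ = 6 := shiftColor_eq_six rfl (by simp)
  have ey2 : c y₂ = 6 := shiftColor_eq_six hy (by simp)
  have ex2 : (circularClique 7 2).Adj 1 (c x₂) := by
    by_cases h : x₂ = x₁
    · exact circAdj_of_eq (h ▸ ex1) rfl
    · exact circAdj_of_eq (shiftColor_eq_four (hx ▸ hne) (hx ▸ hβ1) h) rfl
  obtain ⟨g, hg⟩ := hS.extend_edge (c₁ := 3) (c₂ := 1) h1 h2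
    (circAdj_of_eq ex1 rfl) (circAdj_of_eq ey1 rfl) ex2 (circAdj_of_eq ey2 rfl)
    (circAdj_of_eq rfl rfl)
  exact not_homOff_circ hcol g hg

/-- Each outer neighbour of an edge of vertices of degree three is adjacent to another one. -/
lemma EdgeCritical.adj_of_edge (hG : G.EdgeCritical) (hcol : ¬ G.CircularColorable 7 2)
    {u₁ u₂ x₁ y₁ x₂ y₂ : V} (h1 : G.HasNbrs u₁ u₂ x₁ y₁) (h2 : G.HasNbrs u₂ u₁ x₂ y₂) :
    G.Adj x₁ y₁ ∨ G.Adj x₁ x₂ ∨ G.Adj x₁ y₂ := by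
  obtain ⟨φ, hφ⟩ := hG.exists_homOff (X := {u₁, u₂}) h1.adj.1 (by simp)
  obtain ⟨hne, ⟨hc, hd⟩ | ⟨hc, hd⟩⟩ := edge_extension_fin_three (φ x₁) (φ y₁) (φ x₂) (φ y₂)
    (by
      rintro ⟨i, j, h1', h2', h3', h4', h5'⟩
      obtain ⟨g, hg⟩ := hφ.extend_edge (c₁ := i) (c₂ := j) h1 h2 h1' h2' h3' h4' h5'
      exact not_homOff_top hG.1 g hg)
  · have := adj_of_edge_aux hcol h1 h2 hφ hne hc hd
    tauto
  · have := adj_of_edge_aux hcol h1 h2.swap hφ hne hc hd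
    tauto

section Center

variable {u₁ u₂ u₃ w p q x x' : V}

/-- If `w ≠ x`, moving only `x` to 5 leaves `w` and `x'` at 4, and the path takes 3, 1, 6. -/
lemma center_aux_eq (hcol : ¬ G.CircularColorable 7 2)
    (h1 : G.HasNbrs u₁ u₂ p x) (h3 : G.HasNbrs u₃ u₂ q x') (h2 : G.HasNbrs u₂ u₁ u₃ w)
    (hn : ¬ G.Adj u₁ u₃) (hφ : HomOff G ⊤ {u₁, u₂, u₃} φ)
    (hx : φ x = φ w) (hx' : φ x' = φ w) (hp : φ w ≠ φ p) (hq : φ w ≠ φ q) (hpq : φ p ≠ φ q)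
    (hne : x' ≠ x) : w = x := by
  by_contra hw
  have hS := homOff_shiftColor hφ hpq (S := ∅) (T := {x}) (by simp)
  set c := shiftColor φ (φ p) (φ q) ∅ {x} with hc
  obtain ⟨g, hg⟩ := hS.extend_path (c₁ := 3) (c₂ := 1) (c₃ := 6) h1 h3 h2 hn
    (circAdj_of_eq (shiftColor_eq_zero rfl (by simp)) rfl)
    (circAdj_of_eq (shiftColor_eq_five (hx ▸ hp) (hx ▸ hq) rfl) rfl)
    (circAdj_of_eq (shiftColor_eq_two hpq rfl) rfl)
    (circAdj_of_eq (shiftColor_eq_four (hx' ▸ hp) (hx' ▸ hq) hne) rfl)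
    (circAdj_of_eq (shiftColor_eq_four hp hq hw) rfl)
    (circAdj_of_eq rfl rfl) (circAdj_of_eq rfl rfl)
  exact not_homOff_circ hcol g hg

/-- If `w` and `p` were nonadjacent, `w` could move to 6 and `p` to 5, with `x` at 0 and `q` at 2;
the path then takes 3, 1, 4. -/
lemma center_aux_adj (hcol : ¬ G.CircularColorable 7 2)
    (h1 : G.HasNbrs u₁ u₂ p x) (h3 : G.HasNbrs u₃ u₂ q x) (h2 : G.HasNbrs u₂ u₁ u₃ w)
    (hn : ¬ G.Adj u₁ u₃) (hφ : HomOff G ⊤ {u₁, u₂, u₃} φ)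
    (hx : φ x = φ w) (hp : φ w ≠ φ p) (hq : φ w ≠ φ q) (hpq : φ p ≠ φ q)
    (hne : w ≠ x) : G.Adj w p := by
  by_contra hadj
  have hS := homOff_shiftColor hφ hq (S := {w}) (T := {p}) (by
    rintro a rfl b rfl
    exact hadj)
  obtain ⟨g, hg⟩ := hS.extend_path (c₁ := 3) (c₂ := 1) (c₃ := 4) h1 h3 h2 hn
    (circAdj_of_eq (shiftColor_eq_five hp.symm hpq rfl) rfl)
    (circAdj_of_eq (shiftColor_eq_zero hx hne.symm) rfl)
    (circAdj_of_eq (shiftColor_eq_two hq rfl) rfl)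
    (circAdj_of_eq (shiftColor_eq_zero hx hne.symm) rfl)
    (circAdj_of_eq (shiftColor_eq_six rfl rfl) rfl)
    (circAdj_of_eq rfl rfl) (circAdj_of_eq rfl rfl)
  exact not_homOff_circ hcol g hg

lemma center_aux (hcol : ¬ G.CircularColorable 7 2)
    (h1 : G.HasNbrs u₁ u₂ p x) (h3 : G.HasNbrs u₃ u₂ q x') (h2 : G.HasNbrs u₂ u₁ u₃ w)
    (hn : ¬ G.Adj u₁ u₃) (hφ : HomOff G ⊤ {u₁, u₂, u₃} φ)
    (hx : φ x = φ w) (hx' : φ x' = φ w) (hp : φ w ≠ φ p) (hq : φ w ≠ φ q) (hpq : φ p ≠ φ q) :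
    x' = x ∧ p ≠ q ∧ (w ≠ x → G.Adj w p ∧ G.Adj w q) := by
  have h2' : G.HasNbrs u₂ u₃ u₁ w := h2.swap_left
  have hn' : ¬ G.Adj u₃ u₁ := fun h => hn h.symm
  have hφ' : HomOff G ⊤ {u₃, u₂, u₁} φ := by
    rwa [show ({u₃, u₂, u₁} : Set V) = {u₁, u₂, u₃} by ext; simp; tauto]
  -- If they differed, the two orientations of the path would give `w = x` and `w = x'`.
  have hxx : x' = x := by
    by_contra hne
    have e1 := center_aux_eq hcol h1 h3 h2 hn hφ hx hx' hp hq hpq hne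
    have e2 := center_aux_eq hcol h3 h1 h2' hn' hφ' hx' hx hq hp hpq.symm (Ne.symm hne)
    exact hne (e2.symm.trans e1)
  subst hxx
  refine ⟨rfl, fun h => hpq (by rw [h]), fun hne => ⟨?_, ?_⟩⟩
  · exact center_aux_adj hcol h1 h3 h2 hn hφ hx hp hq hpq hne
  · exact center_aux_adj hcol h3 h1 h2' hn' hφ' hx hq hp hpq.symm hne

/-- Structure around a vertex of degree three with two neighbours of degree three. -/
lemma EdgeCritical.center_structure (hG : G.EdgeCritical) (hcol : ¬ G.CircularColorable 7 2)
    {s t s' t' : V} (h1 : G.HasNbrs u₁ u₂ s t) (h3 : G.HasNbrs u₃ u₂ s' t')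
    (h2 : G.HasNbrs u₂ u₁ u₃ w) (hn : ¬ G.Adj u₁ u₃) :
    ∃ p q x, G.HasNbrs u₁ u₂ p x ∧ G.HasNbrs u₃ u₂ q x ∧ p ≠ q ∧
      (w ≠ x → G.Adj w p ∧ G.Adj w q) := by
  obtain ⟨φ, hφ⟩ := hG.exists_homOff (X := {u₁, u₂, u₃}) h1.adj.1 (by simp)
  obtain ⟨hl, hr, ha, hb, hc, hd⟩ :=
    path_extension_fin_three (φ s) (φ t) (φ w) (φ s') (φ t') (by
      rintro ⟨i, j, k, e1, e2, e3, e4, e5, e6, e7⟩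
      obtain ⟨g, hg⟩ := hφ.extend_path (c₁ := i) (c₂ := j) (c₃ := k) h1 h3 h2 hn
        e1 e2 e3 e4 e5 e6 e7
      exact not_homOff_top hG.1 g hg)
  rcases hl with ⟨l1, l2⟩ | ⟨l1, l2⟩ <;> rcases hr with ⟨r1, r2⟩ | ⟨r1, r2⟩
  · obtain ⟨rfl, h⟩ := center_aux hcol h1 h3 h2 hn hφ l1 r1 l2 r2 (ha l1 r1)
    exact ⟨s, s', _, h1, h3, h⟩
  · obtain ⟨rfl, h⟩ := center_aux hcol h1 h3.swap h2 hn hφ l1 r1 l2 r2 (hb l1 r1)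
    exact ⟨s, t', _, h1, h3.swap, h⟩
  · obtain ⟨rfl, h⟩ := center_aux hcol h1.swap h3 h2 hn hφ l1 r1 l2 r2 (hc l1 r1)
    exact ⟨t, s', _, h1.swap, h3, h⟩
  · obtain ⟨rfl, h⟩ := center_aux hcol h1.swap h3.swap h2 hn hφ l1 r1 l2 r2 (hd l1 r1)
    exact ⟨t, t', _, h1.swap, h3.swap, h⟩

end Center
end Structure
end SimpleGraph

namespace SimpleGraph
-- Contracting a path of vertices of degree three
section Reduction
open scoped Classical

variable {V : Type*} {G H : SimpleGraph V} {u₁ u₂ u₃ w p q x : V}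

/-- A vertex `u₂` of degree three with two nonadjacent neighbours `u₁`, `u₃` of degree three, as
in `EdgeCritical.center_structure`. -/
structure IsCenter (G : SimpleGraph V) (u₁ u₂ u₃ w p q x : V) : Prop where
  left : G.HasNbrs u₁ u₂ p x
  right : G.HasNbrs u₃ u₂ q x
  mid : G.HasNbrs u₂ u₁ u₃ w
  not_adj : ¬ G.Adj u₁ u₃
  p_ne_q : p ≠ q
  adj_w : w ≠ x → G.Adj w p ∧ G.Adj w q

/-- Replace the path `u₁ u₂ u₃` by the single vertex `u₂` adjacent to `p`, `q` and `x`. -/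
def contractPath (G : SimpleGraph V) (u₁ u₂ u₃ p q x : V) : SimpleGraph V where
  Adj a b := (a ∉ ({u₁, u₂, u₃} : Set V) ∧ b ∉ ({u₁, u₂, u₃} : Set V) ∧ G.Adj a b) ∨
    (a = u₂ ∧ b ∈ ({p, q, x} : Set V) ∧ b ≠ u₂) ∨ (b = u₂ ∧ a ∈ ({p, q, x} : Set V) ∧ a ≠ u₂)
  symm := ⟨by
    rintro a b (⟨h1, h2, h3⟩ | h | h)
    · exact Or.inl ⟨h2, h1, h3.symm⟩
    · exact Or.inr (Or.inr h)
    · exact Or.inr (Or.inl h)⟩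
  loopless := ⟨by
    rintro a (⟨-, -, h⟩ | ⟨h1, -, h2⟩ | ⟨h1, -, h2⟩)
    · exact h.ne rfl
    · exact h2 h1
    · exact h2 h1⟩

namespace IsCenter

variable (hc : G.IsCenter u₁ u₂ u₃ w p q x)
include hc

lemma symm : G.IsCenter u₃ u₂ u₁ w q p x :=
  ⟨hc.right, hc.left, hc.mid.swap_left, fun h => hc.not_adj h.symm, hc.p_ne_q.symm,
    fun h => (hc.adj_w h).symm⟩

lemma p_notMem : p ∉ ({u₁, u₂, u₃} : Set V) := by
  rintro (h | h | h)
  · exact hc.left.adj.2.1.ne h.symm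
  · exact hc.left.1 h.symm
  · exact hc.not_adj (h ▸ hc.left.adj.2.1)

lemma x_notMem : x ∉ ({u₁, u₂, u₃} : Set V) := by
  rintro (h | h | h)
  · exact hc.left.adj.2.2.ne h.symm
  · exact hc.left.2.1 h.symm
  · exact hc.not_adj (h ▸ hc.left.adj.2.2)

lemma q_notMem : q ∉ ({u₁, u₂, u₃} : Set V) := by
  have := hc.symm.p_notMem
  simp only [Set.mem_insert_iff, Set.mem_singleton_iff] at this ⊢
  tauto

lemma w_notMem : w ∉ ({u₁, u₂, u₃} : Set V) := by
  rintro (h | h | h)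
  · exact hc.mid.2.1 h.symm
  · exact hc.mid.adj.2.2.ne h.symm
  · exact hc.mid.2.2.1 h.symm

lemma w_ne_p : w ≠ p := by
  intro h
  by_cases hx : w = x
  · exact hc.left.2.2.1 (h.symm.trans hx)
  · exact (hc.adj_w hx).1.ne h

lemma w_ne_q : w ≠ q := hc.symm.w_ne_p

lemma adj_u₂ {y : V} : (G.contractPath u₁ u₂ u₃ p q x).Adj u₂ y ↔ y = p ∨ y = q ∨ y = x := by
  have h1 := hc.p_notMem
  have h2 := hc.q_notMem
  have h3 := hc.x_notMem
  simp only [Set.mem_insert_iff, Set.mem_singleton_iff, not_or] at h1 h2 h3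
  simp only [contractPath, Set.mem_insert_iff, Set.mem_singleton_iff]
  constructor
  · rintro (⟨h, -, -⟩ | ⟨-, h, -⟩ | ⟨-, -, h⟩)
    · simp at h
    · exact h
    · exact absurd rfl h
  · intro h
    refine Or.inr (Or.inl ⟨trivial, h, ?_⟩)
    rcases h with rfl | rfl | rfl
    exacts [h1.2.1, h2.2.1, h3.2.1]

omit hc in
lemma contractPath_adj_of_notMem {a b : V} (ha : a ∉ ({u₁, u₂, u₃} : Set V))
    (hb : b ∉ ({u₁, u₂, u₃} : Set V)) :
    (G.contractPath u₁ u₂ u₃ p q x).Adj a b ↔ G.Adj a b := by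
  have ha' : a ≠ u₂ := by rintro rfl; simp at ha
  have hb' : b ≠ u₂ := by rintro rfl; simp at hb
  simp [contractPath, ha', hb'] at ha hb ⊢
  tauto

lemma colorable_of_le (hH : H ≤ G.contractPath u₁ u₂ u₃ p q x) {φ : V → Fin 3} {c : Fin 3}
    (hφ : ∀ a b, a ∉ ({u₁, u₂, u₃} : Set V) → b ∉ ({u₁, u₂, u₃} : Set V) → H.Adj a b → φ a ≠ φ b)
    (hp : H.Adj u₂ p → c ≠ φ p) (hq : H.Adj u₂ q → c ≠ φ q) (hx : H.Adj u₂ x → c ≠ φ x) :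
    H.Colorable 3 := by
  have key : ∀ y, H.Adj u₂ y → c ≠ φ y := by
    intro y hy
    rcases hc.adj_u₂.1 (hH hy) with rfl | rfl | rfl
    exacts [hp hy, hq hy, hx hy]
  refine ⟨⟨Function.update φ u₂ c, ?_⟩⟩
  intro a b hab
  change Function.update φ u₂ c a ≠ Function.update φ u₂ c b
  by_cases ha : a = u₂
  · subst ha
    rw [Function.update_self, Function.update_of_ne hab.ne']
    exact key b hab
  · by_cases hb : b = u₂
    · subst hb
      rw [Function.update_self, Function.update_of_ne hab.ne]
      exact (key a hab.symm).symm
    · rw [Function.update_of_ne ha, Function.update_of_ne hb]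
      rcases hH hab with h | h | h
      · exact hφ a b h.1 h.2.1 hab
      · exact absurd h.1 ha
      · exact absurd h.1 hb

/-- Every edge of the reduced graph, except possibly `wp` and `wq`, is critical. -/
lemma adj_of_le (hG : G.EdgeCritical) (hH : H ≤ G.contractPath u₁ u₂ u₃ p q x)
    (hcol : ¬ H.Colorable 3) {a b : V} (hab : (G.contractPath u₁ u₂ u₃ p q x).Adj a b)
    (hne : w = x ∨ s(a, b) ≠ s(w, p) ∧ s(a, b) ≠ s(w, q)) : H.Adj a b := by
  by_contra hHab
  apply hcol
  -- Once an edge at `u₂` is missing, at most two colours are forbidden there.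
  have hu2 : ∀ y, ¬ H.Adj u₂ y → y = p ∨ y = q ∨ y = x → H.Colorable 3 := by
    intro y hy hyc
    obtain ⟨φ, hφ⟩ := hG.exists_homOff (X := {u₁, u₂, u₃}) hc.left.adj.1 (by simp)
    have hφ' : ∀ a b, a ∉ ({u₁, u₂, u₃} : Set V) → b ∉ ({u₁, u₂, u₃} : Set V) →
        H.Adj a b → φ a ≠ φ b := fun a b ha hb hab =>
      hφ ha hb ((contractPath_adj_of_notMem ha hb).1 (hH hab))
    rcases hyc with rfl | rfl | rfl
    · obtain ⟨c, h1, h2⟩ := exists_third (φ q) (φ x)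
      exact hc.colorable_of_le hH hφ' (fun h => absurd h hy) (fun _ => h1.symm) (fun _ => h2.symm)
    · obtain ⟨c, h1, h2⟩ := exists_third (φ p) (φ x)
      exact hc.colorable_of_le hH hφ' (fun _ => h1.symm) (fun h => absurd h hy) (fun _ => h2.symm)
    · obtain ⟨c, h1, h2⟩ := exists_third (φ p) (φ q)
      exact hc.colorable_of_le hH hφ' (fun _ => h1.symm) (fun _ => h2.symm) (fun h => absurd h hy)
  by_cases ha : a = u₂
  · subst ha
    exact hu2 b hHab (hc.adj_u₂.1 hab)
  by_cases hb : b = u₂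
  · subst hb
    exact hu2 a (fun h => hHab h.symm) (hc.adj_u₂.1 hab.symm)
  obtain ⟨haX, hbX, hGab⟩ : a ∉ ({u₁, u₂, u₃} : Set V) ∧ b ∉ ({u₁, u₂, u₃} : Set V) ∧ G.Adj a b := by
    rcases hab with h | h | h
    · exact h
    · exact absurd h.1 ha
    · exact absurd h.1 hb
  obtain ⟨φ, hφ⟩ := hG.exists_coloring_delete hGab
  have hX : ∀ c d, G.Adj c d → c ∈ ({u₁, u₂, u₃} : Set V) → φ c ≠ φ d := by
    intro c d hcd hcX
    refine hφ c d hcd fun h => ?_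
    rcases Sym2.eq_iff.1 h with ⟨rfl, -⟩ | ⟨rfl, -⟩
    exacts [haX hcX, hbX hcX]
  -- The deleted edge avoids the path, so the path is properly coloured and some colour `d` is free
  -- at the contracted vertex.
  obtain ⟨d, hd1, hd2, hd3⟩ := not_rainbow_fin_three (φ p) (φ q) (φ x) (φ w) (φ u₂)
    ⟨φ u₁, hX _ _ hc.left.adj.2.1 (by simp), hX _ _ hc.left.adj.2.2 (by simp),
      hX _ _ hc.left.adj.1 (by simp)⟩
    ⟨φ u₃, hX _ _ hc.right.adj.2.1 (by simp), hX _ _ hc.right.adj.2.2 (by simp),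
      hX _ _ hc.right.adj.1 (by simp)⟩
    (hX _ _ hc.mid.adj.2.2 (by simp))
    (by
      by_cases hwx : w = x
      · exact Or.inl (by rw [hwx])
      · obtain ⟨h1, h2⟩ := hc.adj_w hwx
        obtain h | ⟨h3, h4⟩ := hne
        · exact absurd h hwx
        · exact Or.inr ⟨hφ _ _ h1 h3.symm, hφ _ _ h2 h4.symm⟩)
  refine hc.colorable_of_le hH (φ := φ) (fun c e hcX heX hce => ?_) (fun _ => hd1) (fun _ => hd2)
    (fun _ => hd3)
  refine hφ c e ((contractPath_adj_of_notMem hcX heX).1 (hH hce)) fun h => hHab ?_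
  rcases Sym2.eq_iff.1 h with ⟨rfl, rfl⟩ | ⟨rfl, rfl⟩
  exacts [hce, hce.symm]

lemma not_colorable (hG : G.EdgeCritical) : ¬ (G.contractPath u₁ u₂ u₃ p q x).Colorable 3 := by
  rintro ⟨ψ⟩
  have hψ : HomOff G ⊤ {u₁, u₂, u₃} ψ := fun a b ha hb hab =>
    ψ.valid ((contractPath_adj_of_notMem ha hb).2 hab)
  obtain ⟨i, j, k, h1, h2, h3, h4, h5, h6, h7⟩ := path_extension_of_common (ψ p) (ψ q) (ψ x) (ψ w)
    ⟨ψ u₂, ψ.valid (hc.adj_u₂.2 (by simp)), ψ.valid (hc.adj_u₂.2 (by simp)),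
      ψ.valid (hc.adj_u₂.2 (by simp))⟩
  obtain ⟨g, hg⟩ := hψ.extend_path (c₁ := i) (c₂ := j) (c₃ := k) hc.left hc.right hc.mid hc.not_adj
    h1 h2 h3 h4 h5 h6 h7
  exact not_homOff_top hG.1 g hg

lemma not_circ_contractPath (hcol : ¬ G.CircularColorable 7 2) :
    ¬ (G.contractPath u₁ u₂ u₃ p q x).CircularColorable 7 2 := by
  rintro ⟨ψ⟩
  have hψ : HomOff G (circularClique 7 2) {u₁, u₂, u₃} ψ := fun a b ha hb hab =>
    ψ.map_adj ((contractPath_adj_of_notMem ha hb).2 hab)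
  have hu : ∀ y, y = p ∨ y = q ∨ y = x → circAdj (ψ u₂) (ψ y) := fun y hy =>
    (circAdj_iff _ _).2 (ψ.map_adj (hc.adj_u₂.2 hy))
  obtain ⟨j, h5, ⟨i, h1, h2, h6⟩, k, h3, h4, h7⟩ := exists_circAdj_path (ψ u₂) (ψ p) (hu p (by simp))
    (ψ q) (hu q (by simp)) (ψ x) (hu x (by simp)) (ψ w)
  rw [circAdj_iff] at h1 h2 h3 h4 h5 h6 h7
  obtain ⟨g, hg⟩ := hψ.extend_path (c₁ := i) (c₂ := j) (c₃ := k) hc.left hc.right hc.mid hc.not_adj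
    h1 h2 h3 h4 h5 h6 h7
  exact not_homOff_circ hcol g hg

/-- Covers the case where `w` has degree three and becomes isolated in the reduced graph: its colour
there is meaningless, so it is recoloured along with the path. -/
lemma not_circ_of_claw (hcol : ¬ G.CircularColorable 7 2) (hwx : w ≠ x)
    (hw : G.HasNbrs w u₂ p q) (hu : ∀ y, y = p ∨ y = q ∨ y = x → H.Adj u₂ y)
    (hH : ∀ a b, a ∉ ({w, u₁, u₂, u₃} : Set V) → b ∉ ({w, u₁, u₂, u₃} : Set V) → G.Adj a b →
      H.Adj a b) :
    ¬ H.CircularColorable 7 2 := by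
  rintro ⟨ψ⟩
  have hψ : HomOff G (circularClique 7 2) (insert w {u₁, u₂, u₃}) ψ := fun a b ha hb hab =>
    ψ.map_adj (hH a b ha hb hab)
  have hu : ∀ y, y = p ∨ y = q ∨ y = x → circAdj (ψ u₂) (ψ y) := fun y hy =>
    (circAdj_iff _ _).2 (ψ.map_adj (hu y hy))
  obtain ⟨j, ⟨l, h8, h9, h5⟩, ⟨i, h1, h2, h6⟩, k, h3, h4, h7⟩ :=
    exists_circAdj_claw (ψ u₂) (ψ p) (hu p (by simp))
    (ψ q) (hu q (by simp)) (ψ x) (hu x (by simp))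
  rw [circAdj_iff] at h1 h2 h3 h4 h5 h6 h7 h8 h9
  have hψ' := hψ.update (c := l) (by
    intro y hy hyX
    rcases (hw.2.2.2 y).1 hy with rfl | rfl | rfl
    · simp at hyX
    · exact h8
    · exact h9)
  have ep : Function.update ψ w l p = ψ p := Function.update_of_ne hc.w_ne_p.symm _ _
  have eq : Function.update ψ w l q = ψ q := Function.update_of_ne hc.w_ne_q.symm _ _
  have ex : Function.update ψ w l x = ψ x := Function.update_of_ne hwx.symm _ _
  obtain ⟨g, hg⟩ := hψ'.extend_path (c₁ := i) (c₂ := j) (c₃ := k) hc.left hc.right hc.mid hc.not_adj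
    (ep ▸ h1) (ex ▸ h2) (eq ▸ h3) (ex ▸ h4) (by simpa using h5.symm) h6 h7
  exact not_homOff_circ hcol g hg

end IsCenter
end Reduction
end SimpleGraph

namespace SimpleGraph
-- Degrees, copies and edge counts
section Counting
open scoped Classical

variable {V : Type*} [Fintype V] {G H : SimpleGraph V} {u₁ u₂ u₃ w p q x : V}

lemma hasNbrs_of_degree {u a b c : V} (hd : G.degree u = 3) (ha : G.Adj u a) (hb : G.Adj u b)
    (hc : G.Adj u c) (hab : a ≠ b) (hac : a ≠ c) (hbc : b ≠ c) : G.HasNbrs u a b c := by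
  refine ⟨hab, hac, hbc, ?_⟩
  have hsub : ({a, b, c} : Finset V) ⊆ G.neighborFinset u := by
    intro y
    simp only [Finset.mem_insert, Finset.mem_singleton, mem_neighborFinset]
    rintro (rfl | rfl | rfl) <;> assumption
  have heq := Finset.eq_of_subset_of_card_le hsub (by
    rw [card_neighborFinset_eq_degree, hd, Finset.card_eq_three.2 ⟨a, b, c, hab, hac, hbc, rfl⟩])
  intro y
  rw [← mem_neighborFinset, ← heq]
  simp

lemma exists_hasNbrs {u a : V} (hd : G.degree u = 3) (ha : G.Adj u a) :
    ∃ b c, G.HasNbrs u a b c := by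
  have h2 : ((G.neighborFinset u).erase a).card = 2 := by
    rw [Finset.card_erase_of_mem (by simpa using ha), card_neighborFinset_eq_degree, hd]
  obtain ⟨b, c, hbc, h⟩ := Finset.card_eq_two.1 h2
  have hb : b ∈ (G.neighborFinset u).erase a := by simp [h]
  have hc : c ∈ (G.neighborFinset u).erase a := by simp [h]
  simp only [Finset.mem_erase, mem_neighborFinset] at hb hc
  exact ⟨b, c, hasNbrs_of_degree hd ha hb.2 hc.2 hb.1.symm hc.1.symm hbc⟩

lemma exists_hasNbrs_of_two {u a b : V} (hd : G.degree u = 3) (ha : G.Adj u a) (hb : G.Adj u b)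
    (hab : a ≠ b) : ∃ c, G.HasNbrs u a b c := by
  obtain ⟨c, d, h⟩ := exists_hasNbrs hd ha
  rcases (h.2.2.2 b).1 hb with rfl | rfl | rfl
  · exact absurd rfl hab
  · exact ⟨d, h⟩
  · exact ⟨c, h.swap⟩

lemma EdgeCritical.three_le_degree (hG : G.EdgeCritical) {u y : V} (h : G.Adj u y) :
    3 ≤ G.degree u := by
  by_contra! hd
  obtain ⟨φ, hφ⟩ := hG.exists_homOff (X := {u}) h rfl
  obtain ⟨c, hc⟩ : ∃ c, c ∉ (G.neighborFinset u).image φ := by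
    by_contra! hall
    have h3 := Finset.card_le_card (fun c _ => hall c : (Finset.univ : Finset (Fin 3)) ⊆ _)
    have := Finset.card_image_le (s := G.neighborFinset u) (f := φ)
    rw [card_neighborFinset_eq_degree] at this
    simp at h3
    omega
  rw [← LawfulSingleton.insert_empty_eq u] at hφ
  refine not_homOff_top hG.1 _ (hφ.update (c := c) fun z hz _ hcz => hc ?_)
  exact Finset.mem_image.2 ⟨z, by simpa using hz, hcz.symm⟩

lemma exists_edgeCritical_le (hG : ¬ G.Colorable 3) : ∃ H ≤ G, H.EdgeCritical := by
  obtain ⟨H, hH, hmin⟩ := exists_minimal_le_of_wellFoundedLT (fun H : SimpleGraph V => ¬ H.Colorable 3) G hG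
  exact ⟨H, hH, hmin.1, fun K hK hKc => le_antisymm hK (hmin.2 hKc hK)⟩

omit [Fintype V] in
-- The image of `A` is a non-3-colourable subgraph, so minimality makes it all of `G`.
lemma EdgeCritical.copy_surj {W : Type*} {A : SimpleGraph W} (hG : G.EdgeCritical)
    (hA : ¬ A.Colorable 3) (f : Copy A G) {a b : V} (hab : G.Adj a b) :
    ∃ i j, A.Adj i j ∧ f i = a ∧ f j = b := by
  have hle : A.map f.toEmbedding ≤ G := by
    rw [map_le_iff_le_comap]
    exact fun i j h => f.toHom.map_adj h
  have := hG.2 _ hle fun h => hA (h.of_hom (Embedding.map f.toEmbedding A).toHom)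
  rw [← this] at hab
  obtain ⟨i, j, h, h1, h2⟩ := (map_adj _ _ _ _).1 hab
  exact ⟨i, j, h, h1, h2⟩

omit [Fintype V] in
lemma EdgeCritical.support_le_of_copy {W : Type*} [Fintype W] {A : SimpleGraph W}
    (hG : G.EdgeCritical) (hA : ¬ A.Colorable 3) (f : Copy A G) :
    G.support.ncard ≤ Fintype.card W := by
  have hsub : G.support ⊆ Set.range f := by
    rintro a ⟨b, hab⟩
    obtain ⟨i, -, -, h, -⟩ := hG.copy_surj hA f hab
    exact ⟨i, h⟩
  calc G.support.ncard ≤ (Set.range f).ncard := Set.ncard_le_ncard hsub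
    _ ≤ Fintype.card W := by
      rw [← Set.image_univ, ← Nat.card_eq_fintype_card, ← Set.ncard_univ]
      exact Set.ncard_image_le

lemma card_edgeFinset_le_of_copy {W : Type*} [Fintype W] {A : SimpleGraph W} (f : Copy A G) :
    A.edgeFinset.card ≤ G.edgeFinset.card := by
  refine Finset.card_le_card_of_injOn (Sym2.map f) ?_ (Sym2.map.injective f.injective).injOn
  intro e he
  induction e with
  | h a b =>
    simp only [Finset.mem_coe, mem_edgeFinset, mem_edgeSet, Sym2.map_mk] at he ⊢
    exact f.toHom.map_adj he

/-- `R` collects edges lost in passing from `G` to `H`, and `N` contains the edges gained. -/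
lemma card_edgeFinset_add_le {R N : Finset (Sym2 V)} (hR : R ⊆ G.edgeFinset)
    (h : ∀ a b, H.Adj a b → s(a, b) ∈ N ∨ G.Adj a b ∧ s(a, b) ∉ R) :
    H.edgeFinset.card + R.card ≤ G.edgeFinset.card + N.card := by
  have hsub : H.edgeFinset ⊆ N ∪ (G.edgeFinset \ R) := by
    intro e he
    induction e with
    | h a b =>
      rcases h a b (by simpa using he) with h | ⟨h1, h2⟩
      · exact Finset.mem_union_left _ h
      · exact Finset.mem_union_right _ (Finset.mem_sdiff.2 ⟨by simpa using h1, h2⟩)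
  have h1 := (Finset.card_le_card hsub).trans (Finset.card_union_le _ _)
  have h2 := Finset.card_sdiff_add_card_eq_card hR
  omega

namespace IsCenter

variable (hc : G.IsCenter u₁ u₂ u₃ w p q x)
include hc

/-- Seven edges meet the path, and three replace them. -/
lemma card_edgeFinset_add_four_le (hH : H ≤ G.contractPath u₁ u₂ u₃ p q x) :
    H.edgeFinset.card + 4 ≤ G.edgeFinset.card := by
  have hp := hc.p_notMem
  have hq := hc.q_notMem
  have hx := hc.x_notMem
  have hw := hc.w_notMem
  have h12 := hc.left.adj.1.ne
  have h32 := hc.right.adj.1.ne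
  have h13 := hc.mid.1
  have hpx := hc.left.2.2.1
  have hqx := hc.right.2.2.1
  simp only [Set.mem_insert_iff, Set.mem_singleton_iff, not_or] at hp hq hx hw
  obtain ⟨hp1, hp2, hp3⟩ := hp
  obtain ⟨hq1, hq2, hq3⟩ := hq
  obtain ⟨hx1, hx2, hx3⟩ := hx
  obtain ⟨hw1, hw2, hw3⟩ := hw
  have := card_edgeFinset_add_le (G := G) (H := H)
    (R := {s(u₁, u₂), s(u₂, u₃), s(u₂, w), s(u₁, p), s(u₁, x), s(u₃, q), s(u₃, x)})
    (N := {s(u₂, p), s(u₂, q), s(u₂, x)}) (by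
      intro e
      simp only [Finset.mem_insert, Finset.mem_singleton, mem_edgeFinset]
      rintro (rfl | rfl | rfl | rfl | rfl | rfl | rfl) <;> rw [mem_edgeSet]
      exacts [hc.left.adj.1, hc.mid.adj.2.1, hc.mid.adj.2.2, hc.left.adj.2.1, hc.left.adj.2.2,
        hc.right.adj.2.1, hc.right.adj.2.2])
    (by
      intro a b hab
      rcases hH hab with ⟨h1, h2, h3⟩ | ⟨rfl, h, -⟩ | ⟨rfl, h, -⟩
      · refine Or.inr ⟨h3, ?_⟩
        simp only [Set.mem_insert_iff, Set.mem_singleton_iff, not_or] at h1 h2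
        simp [h1, h2]
      · left
        rcases h with rfl | rfl | rfl <;> simp
      · left
        rcases h with rfl | rfl | rfl <;> simp)
  have hN : ({s(u₂, p), s(u₂, q), s(u₂, x)} : Finset (Sym2 V)).card ≤ 3 := Finset.card_le_three
  have hR : ({s(u₁, u₂), s(u₂, u₃), s(u₂, w), s(u₁, p), s(u₁, x), s(u₃, q), s(u₃, x)} :
      Finset (Sym2 V)).card = 7 := by
    repeat rw [Finset.card_insert_of_notMem (by
      simp [h12, h32, h13, hpx, hqx, hp1, hp3, hq3, hx3, hw1, hw3,
        h12.symm, h32.symm, h13.symm, Ne.symm hp1, Ne.symm hp2, Ne.symm hp3,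
        Ne.symm hq1, Ne.symm hq2, Ne.symm hq3, Ne.symm hx1, Ne.symm hx2, Ne.symm hx3,
        Ne.symm hw1, Ne.symm hw2, Ne.symm hw3])]
    rfl
  omega

lemma card_edgeFinset_add_six_le (hH : H ≤ G.contractPath u₁ u₂ u₃ p q x) (hwx : w ≠ x)
    (hp : ¬ H.Adj w p) (hq : ¬ H.Adj w q) :
    H.edgeFinset.card + 6 ≤ G.edgeFinset.card := by
  obtain ⟨hwp, hwq⟩ := hc.adj_w hwx
  have h2 := card_edgeFinset_add_le (G := G.contractPath u₁ u₂ u₃ p q x) (H := H)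
    (R := {s(w, p), s(w, q)}) (N := ∅) (by
      intro e
      simp only [Finset.mem_insert, Finset.mem_singleton, mem_edgeFinset]
      rintro (rfl | rfl) <;> rw [mem_edgeSet]
      · exact (contractPath_adj_of_notMem hc.w_notMem hc.p_notMem).2 hwp
      · exact (contractPath_adj_of_notMem hc.w_notMem hc.q_notMem).2 hwq)
    (by
      intro a b hab
      refine Or.inr ⟨hH hab, ?_⟩
      simp only [Finset.mem_insert, Finset.mem_singleton, Sym2.eq_iff]
      rintro ((⟨rfl, rfl⟩ | ⟨rfl, rfl⟩) | (⟨rfl, rfl⟩ | ⟨rfl, rfl⟩))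
      exacts [hp hab, hp hab.symm, hq hab, hq hab.symm])
  have hR : ({s(w, p), s(w, q)} : Finset (Sym2 V)).card = 2 :=
    Finset.card_pair (by simp [hc.p_ne_q, hc.w_ne_q])
  have h4 := hc.card_edgeFinset_add_four_le le_rfl
  simp only [Finset.card_empty] at h2
  omega

omit [Fintype V] in
lemma mem_support_of_mem (hH : ∀ a b, (G.contractPath u₁ u₂ u₃ p q x).Adj a b →
    s(a, b) ≠ s(w, p) → s(a, b) ≠ s(w, q) → H.Adj a b) {y : V} (hy : y ∈ G.support)
    (h1 : y ≠ u₁) (h3 : y ≠ u₃) (hw : y ≠ w) : y ∈ H.support := by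
  have hw2 := hc.w_notMem
  have hp2 := hc.p_notMem
  have hq2 := hc.q_notMem
  simp only [Set.mem_insert_iff, Set.mem_singleton_iff, not_or] at hw2 hp2 hq2
  have hu : ∀ z, z = p ∨ z = q ∨ z = x → H.Adj u₂ z := fun z hz =>
    hH _ _ (hc.adj_u₂.2 hz) (by simp [Ne.symm hw2.2.1, Ne.symm hp2.2.1])
      (by simp [Ne.symm hw2.2.1, Ne.symm hq2.2.1])
  by_cases hy2 : y = u₂
  · subst hy2
    exact ⟨p, hu p (by simp)⟩
  by_cases hyc : y = p ∨ y = q ∨ y = x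
  · exact ⟨u₂, (hu y hyc).symm⟩
  push Not at hyc
  obtain ⟨z, hz⟩ := hy
  have hz : G.Adj y z := hz
  have hzX : z ∉ ({u₁, u₂, u₃} : Set V) := by
    rintro (rfl | rfl | rfl)
    · have := (hc.left.2.2.2 y).1 hz.symm
      tauto
    · have := (hc.mid.2.2.2 y).1 hz.symm
      tauto
    · have := (hc.right.2.2.2 y).1 hz.symm
      tauto
  exact ⟨z, hH y z ((contractPath_adj_of_notMem (by simp [h1, h3, hy2]) hzX).2 hz)
    (by simp [hw, hyc]) (by simp [hw, hyc])⟩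

end IsCenter
end Counting
end SimpleGraph

namespace SimpleGraph

/-! ### The exceptional graphs K_4 and W_6 -/

instance : DecidableRel (wheelGraph 6).Adj
  | none, none => isFalse id
  | none, some _ => isTrue trivial
  | some _, none => isTrue trivial
  | some i, some j => inferInstanceAs (Decidable ((cycleGraph 5).Adj i j))

lemma card_edgeFinset_wheelGraph_six : (wheelGraph 6).edgeFinset.card = 10 := by
  decide +kernel

lemma card_edgeFinset_top_four : (⊤ : SimpleGraph (Fin 4)).edgeFinset.card = 6 := by
  decide +kernel

lemma not_colorable_wheelGraph_six : ¬ (wheelGraph 6).Colorable 3 := by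
  rintro ⟨φ⟩
  refine not_wheel_coloring_fin_three (φ none) (φ (some (0 : Fin 5))) (φ (some (1 : Fin 5))) (φ (some (2 : Fin 5)))
    (φ (some (3 : Fin 5))) (φ (some (4 : Fin 5))) ⟨⟨?_, ?_, ?_, ?_, ?_⟩, ?_, ?_, ?_, ?_, ?_⟩ <;>
    exact φ.valid (by decide)

lemma not_colorable_top_four : ¬ (⊤ : SimpleGraph (Fin 4)).Colorable 3 := by
  intro h
  have := h.card_le_of_pairwise_adj id (fun i j hij => hij)
  simp at this

section Reduction
open scoped Classical

lemma cycleGraph_five_adj : ∀ i j : Fin 5, (cycleGraph 5).Adj i j → j = i + 1 ∨ i = j + 1 := by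
  decide

variable {V : Type*} {G H : SimpleGraph V} {u₁ u₂ u₃ w p q x : V}

lemma wheelGraph_six_isContained {h : V} {c : Fin 5 → V} (hinj : Function.Injective c)
    (hh : ∀ i, G.Adj h (c i)) (hc : ∀ i, G.Adj (c i) (c (i + 1))) : wheelGraph 6 ⊑ G := by
  refine ⟨⟨⟨fun o => Option.elim o h c, ?_⟩, ?_⟩⟩
  · rintro (_ | i) (_ | j) hij
    · exact hij.elim
    · exact hh j
    · exact (hh i).symm
    · rcases cycleGraph_five_adj i j hij with rfl | rfl
      · exact hc i
      · exact (hc j).symm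
  · rintro (_ | i) (_ | j) hij
    · rfl
    · exact absurd hij (hh j).ne
    · exact absurd hij.symm (hh i).ne
    · exact congrArg some (hinj hij)

lemma top_four_isContained {a b c d : V} (hab : G.Adj a b) (hac : G.Adj a c) (had : G.Adj a d)
    (hbc : G.Adj b c) (hbd : G.Adj b d) (hcd : G.Adj c d) : (⊤ : SimpleGraph (Fin 4)) ⊑ G := by
  have hf : ∀ i j : Fin 4, i ≠ j → G.Adj (![a, b, c, d] i) (![a, b, c, d] j) := by
    intro i j hij
    fin_cases i <;> fin_cases j <;> first
      | exact absurd rfl hij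
      | assumption
      | (apply Adj.symm; assumption)
  refine ⟨⟨⟨![a, b, c, d], fun {i j} hij => hf i j hij⟩, fun i j hij => ?_⟩⟩
  by_contra hne
  exact (hf i j hne).ne hij

/-- The lower bounds for the number of edges, including the exceptional graphs. -/
def EdgeBound [Fintype V] (G : SimpleGraph V) : Prop :=
  17 * G.support.ncard ≤ 10 * G.edgeFinset.card + 8 ∧
  (¬ (⊤ : SimpleGraph (Fin 4)) ⊑ G → 17 * G.support.ncard ≤ 10 * G.edgeFinset.card + 2) ∧
  (¬ (⊤ : SimpleGraph (Fin 4)) ⊑ G → ¬ wheelGraph 6 ⊑ G →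
    17 * G.support.ncard ≤ 10 * G.edgeFinset.card)

/-- At most 4 nonisolated vertices and at least 6 edges: 17·4 = 10·6 + 8. -/
lemma EdgeCritical.edgeBound_of_top_four [Fintype V] (hG : G.EdgeCritical)
    (h : (⊤ : SimpleGraph (Fin 4)) ⊑ G) : G.EdgeBound := by
  refine ⟨?_, fun h' => absurd h h', fun h' => absurd h h'⟩
  obtain ⟨f⟩ := h
  have h1 := hG.support_le_of_copy not_colorable_top_four f
  have h2 : 6 ≤ G.edgeFinset.card := by
    refine le_of_eq_of_le ?_ (card_edgeFinset_le_of_copy f)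
    convert card_edgeFinset_top_four.symm
  rw [Fintype.card_fin] at h1
  omega

/-- Here 17·6 = 10·10 + 2. -/
lemma EdgeCritical.edgeBound_of_wheelGraph_six [Fintype V] (hG : G.EdgeCritical) (h : wheelGraph 6 ⊑ G) :
    G.EdgeBound := by
  obtain ⟨f⟩ := id h
  have h1 := hG.support_le_of_copy not_colorable_wheelGraph_six f
  have h2 : 10 ≤ G.edgeFinset.card := by
    refine le_of_eq_of_le ?_ (card_edgeFinset_le_of_copy f)
    convert card_edgeFinset_wheelGraph_six.symm
  have h5 : Fintype.card (Option (Fin (6 - 1))) = 6 := rfl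
  rw [h5] at h1
  exact ⟨by omega, fun _ => by omega, fun _ h' => absurd h h'⟩

/-! ### The inductive step -/

namespace IsCenter

variable (hc : G.IsCenter u₁ u₂ u₃ w p q x)
include hc

/-- By criticality the contracted graph is K_4 on `u₂`, `p`, `q`, `x`. If `w ≠ x`, then `w` would be
a further neighbour of `u₂`; so `w = x` is the hub of a wheel with rim `p`, `u₁`, `u₂`, `u₃`, `q`.
-/
lemma wheelGraph_six_isContained_of_top_four
    (hcrit : (G.contractPath u₁ u₂ u₃ p q x).EdgeCritical)
    (h : (⊤ : SimpleGraph (Fin 4)) ⊑ G.contractPath u₁ u₂ u₃ p q x) : wheelGraph 6 ⊑ G := by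
  obtain ⟨f⟩ := h
  have hadj : ∀ i j, i ≠ j → (G.contractPath u₁ u₂ u₃ p q x).Adj (f i) (f j) := fun i j hij =>
    f.toHom.map_adj hij
  have hsurj : ∀ y ∈ (G.contractPath u₁ u₂ u₃ p q x).support, ∃ i, f i = y := by
    rintro a ⟨b, hab⟩
    obtain ⟨i, -, -, h, -⟩ := hcrit.copy_surj not_colorable_top_four f hab
    exact ⟨i, h⟩
  have hu : ∀ y, y = p ∨ y = q ∨ y = x → (G.contractPath u₁ u₂ u₃ p q x).Adj u₂ y := fun y hy =>
    hc.adj_u₂.2 hy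
  obtain ⟨i, hi⟩ := hsurj u₂ ⟨p, hu p (by simp)⟩
  obtain ⟨j, hj⟩ := hsurj p ⟨u₂, (hu p (by simp)).symm⟩
  obtain ⟨k, hk⟩ := hsurj q ⟨u₂, (hu q (by simp)).symm⟩
  obtain ⟨l, hl⟩ := hsurj x ⟨u₂, (hu x (by simp)).symm⟩
  have hfadj : ∀ a b, a ∉ ({u₁, u₂, u₃} : Set V) → b ∉ ({u₁, u₂, u₃} : Set V) →
      ∀ i j, f i = a → f j = b → a ≠ b → G.Adj a b := by
    rintro _ _ ha hb i j rfl rfl hne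
    exact (contractPath_adj_of_notMem ha hb).1 (hadj i j (by rintro rfl; exact hne rfl))
  have hpq := hfadj p q hc.p_notMem hc.q_notMem j k hj hk hc.p_ne_q
  have hpx := hfadj p x hc.p_notMem hc.x_notMem j l hj hl hc.left.2.2.1
  have hqx := hfadj q x hc.q_notMem hc.x_notMem k l hk hl hc.right.2.2.1
  have hwx : w = x := by
    by_contra hwx
    obtain ⟨hwp, -⟩ := hc.adj_w hwx
    have hwp' := (contractPath_adj_of_notMem (p := p) (q := q) (x := x) hc.w_notMem hc.p_notMem).2 hwp
    obtain ⟨m, hm⟩ := hsurj w ⟨p, hwp'⟩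
    have hmi : m ≠ i := by
      rintro rfl
      exact hc.w_notMem (by simp [← hm, hi])
    have := hadj i m hmi.symm
    rw [hi, hm] at this
    rcases hc.adj_u₂.1 this with h | h | h
    exacts [hc.w_ne_p h, hc.w_ne_q h, hwx h]
  subst hwx
  refine wheelGraph_six_isContained (h := w) (c := ![p, u₁, u₂, u₃, q]) ?_ ?_ ?_
  · have h12 := hc.left.adj.1.ne
    have h32 := hc.right.adj.1.ne
    have h13 := hc.mid.1
    have hp := hc.p_notMem
    have hq := hc.q_notMem
    have hpq := hc.p_ne_q
    simp only [Set.mem_insert_iff, Set.mem_singleton_iff, not_or] at hp hq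
    obtain ⟨hp1, hp2, hp3⟩ := hp
    obtain ⟨hq1, hq2, hq3⟩ := hq
    intro i j hij
    fin_cases i <;> fin_cases j <;> first
      | rfl
      | exact absurd hij (by assumption)
      | exact absurd hij.symm (by assumption)
  · intro i
    fin_cases i
    exacts [hpx.symm, hc.left.adj.2.2.symm, hc.mid.adj.2.2.symm, hc.right.adj.2.2.symm, hqx.symm]
  · intro i
    fin_cases i
    exacts [hc.left.adj.2.1.symm, hc.left.adj.1, hc.mid.adj.2.1, hc.right.adj.2.1, hpq.symm]

end IsCenter

lemma four_le_degree_of_reduced [Fintype V]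
    (hH : ∀ y, H.Adj p y → y = u₂ ∨ G.Adj p y ∧ y ≠ u₁ ∧ y ≠ w)
    (h1 : G.Adj p u₁) (hw : G.Adj p w) (h1w : u₁ ≠ w) (hd : 3 ≤ H.degree p) : 4 ≤ G.degree p := by
  have hsub : (H.neighborFinset p).erase u₂ ⊆ ((G.neighborFinset p).erase u₁).erase w := by
    intro y hy
    simp only [Finset.mem_erase, mem_neighborFinset] at hy ⊢
    have := hH y hy.2
    tauto
  have hle := Finset.card_le_card hsub
  have hcard : (((G.neighborFinset p).erase u₁).erase w).card = G.degree p - 1 - 1 := by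
    rw [Finset.card_erase_of_mem (by simpa using ⟨h1w.symm, hw⟩),
      Finset.card_erase_of_mem (by simpa using h1), card_neighborFinset_eq_degree]
  have := Finset.pred_card_le_card_erase (s := H.neighborFinset p) (a := u₂)
  rw [card_neighborFinset_eq_degree] at this
  omega

lemma five_le_degree_of_reduced [Fintype V] (hH : ∀ y, H.Adj w y → G.Adj w y ∧ y ≠ u₂ ∧ y ≠ p)
    (h2 : G.Adj w u₂) (hp : G.Adj w p) (h2p : u₂ ≠ p) (hd : 3 ≤ H.degree w) : 5 ≤ G.degree w := by
  have hsub : H.neighborFinset w ⊆ ((G.neighborFinset w).erase u₂).erase p := by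
    intro y hy
    simp only [Finset.mem_erase, mem_neighborFinset] at hy ⊢
    have := hH y hy
    tauto
  have hle := Finset.card_le_card hsub
  rw [Finset.card_erase_of_mem (by simpa using ⟨h2p.symm, hp⟩),
    Finset.card_erase_of_mem (by simpa using h2), card_neighborFinset_eq_degree,
    card_neighborFinset_eq_degree] at hle
  omega

/-- Either the bound follows from that for smaller graphs, or the vertices around a center have
large degree. -/
lemma IsCenter.edgeBound_or [Fintype V] (hc : G.IsCenter u₁ u₂ u₃ w p q x) (hG : G.EdgeCritical)
    (hcol : ¬ G.CircularColorable 7 2)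
    (h6 : ¬ wheelGraph 6 ⊑ G)
    (ih : ∀ H : SimpleGraph V, H.EdgeCritical → ¬ H.CircularColorable 7 2 →
      H.edgeFinset.card < G.edgeFinset.card → H.EdgeBound) :
    17 * G.support.ncard ≤ 10 * G.edgeFinset.card ∨
      (w ≠ x ∧ 5 ≤ G.degree w ∧ (4 ≤ G.degree p ∨ 4 ≤ G.degree q)) := by
  have hp := hc.p_notMem
  have hq := hc.q_notMem
  have hx := hc.x_notMem
  have hw := hc.w_notMem
  simp only [Set.mem_insert_iff, Set.mem_singleton_iff, not_or] at hp hq hx hw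
  obtain ⟨H, hle, hH⟩ := exists_edgeCritical_le (hc.not_colorable hG)
  by_cases hfull : H = G.contractPath u₁ u₂ u₃ p q x
  · left
    have hcard := hc.card_edgeFinset_add_four_le hle
    have hb := ih H hH (hfull ▸ hc.not_circ_contractPath hcol) (by omega)
    have hK : ¬ (⊤ : SimpleGraph (Fin 4)) ⊑ H := fun h =>
      h6 (hc.wheelGraph_six_isContained_of_top_four (hfull ▸ hH) (hfull ▸ h))
    have hsub : G.support ⊆ H.support ∪ {u₁, u₃} := by
      intro y hy
      by_contra hn
      simp only [Set.mem_union, Set.mem_insert_iff, Set.mem_singleton_iff, not_or] at hn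
      by_cases hyw : y = w
      · subst hyw
        by_cases hyx : y = x
        · exact hn.1 ⟨u₂, hfull ▸ (hc.adj_u₂.2 (by simp [hyx])).symm⟩
        · exact hn.1 ⟨p, hfull ▸ (contractPath_adj_of_notMem hc.w_notMem hc.p_notMem).2
            (hc.adj_w hyx).1⟩
      · exact hn.1 (hc.mem_support_of_mem (fun a b hab _ _ => hfull ▸ hab) hy hn.2.1 hn.2.2 hyw)
    have h1 := (Set.ncard_le_ncard hsub).trans (Set.ncard_union_le _ _)
    have h2 := Set.ncard_insert_le u₁ {u₃}
    rw [Set.ncard_singleton] at h2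
    -- Two vertices and four edges are lost: 17·2 + 2 ≤ 10·4.
    have := hb.2.1 hK
    omega
  · obtain ⟨a, b, hab, hnab⟩ : ∃ a b, (G.contractPath u₁ u₂ u₃ p q x).Adj a b ∧ ¬ H.Adj a b := by
      by_contra! hall
      exact hfull (le_antisymm hle fun a b hab => hall a b hab)
    have hcrit : ∀ a b, (G.contractPath u₁ u₂ u₃ p q x).Adj a b →
        s(a, b) ≠ s(w, p) → s(a, b) ≠ s(w, q) → H.Adj a b := fun a b hab h1 h2 =>
      hc.adj_of_le hG hle hH.1 hab (Or.inr ⟨h1, h2⟩)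
    have hwx : w ≠ x := fun h => hnab (hc.adj_of_le hG hle hH.1 hab (Or.inl h))
    obtain ⟨hwp, hwq⟩ := hc.adj_w hwx
    have hmiss : ¬ H.Adj w p ∨ ¬ H.Adj w q := by
      by_contra! hall
      refine hnab (hcrit a b hab ?_ ?_) <;> intro h <;>
        rcases Sym2.eq_iff.1 h with ⟨rfl, rfl⟩ | ⟨rfl, rfl⟩
      exacts [hnab hall.1, hnab hall.1.symm, hnab hall.2, hnab hall.2.symm]
    have hu : ∀ y, y = p ∨ y = q ∨ y = x → H.Adj u₂ y := fun z hz =>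
      hcrit _ _ (hc.adj_u₂.2 hz) (by simp [Ne.symm hw.2.1, Ne.symm hp.2.1])
        (by simp [Ne.symm hw.2.1, Ne.symm hq.2.1])
    have hoff : ∀ y z, y ≠ u₂ → H.Adj y z → z = u₂ ∨ G.Adj y z ∧ z ≠ u₁ ∧ z ≠ u₂ ∧ z ≠ u₃ := by
      intro y z hy hyz
      rcases hle hyz with ⟨-, h, h'⟩ | h | h
      · simp only [Set.mem_insert_iff, Set.mem_singleton_iff, not_or] at h
        exact Or.inr ⟨h', h⟩
      · exact absurd h.1 hy
      · exact Or.inl h.1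
    have hwu : ¬ H.Adj w u₂ := by
      intro h
      rcases hc.adj_u₂.1 (hle h.symm) with h | h | h
      exacts [hc.w_ne_p h, hc.w_ne_q h, hwx h]
    have hwH : ∀ y, H.Adj w y → G.Adj w y ∧ y ≠ u₂ := by
      intro y hy
      rcases hoff w y hw.2.1 hy with h | h
      · exact absurd (h ▸ hy) hwu
      · exact ⟨h.1, h.2.2.1⟩
    have hw3 := hG.three_le_degree hwp
    rcases hw3.eq_or_lt with hd | hd
    · left
      have hwn : G.HasNbrs w u₂ p q := hasNbrs_of_degree hd.symm hc.mid.adj.2.2.symm hwp hwq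
        (Ne.symm hp.2.1) (Ne.symm hq.2.1) hc.p_ne_q
      -- Having lost `u₂`, `w` keeps at most two neighbours, too few for a nonisolated vertex of
      -- `H`.
      have hws : ∀ y, ¬ H.Adj w y := by
        intro y hy
        have h3 := hH.three_le_degree hy
        have hsub : H.neighborFinset w ⊆ (G.neighborFinset w).erase u₂ := by
          intro z hz
          simp only [Finset.mem_erase, mem_neighborFinset] at hz ⊢
          exact (hwH z hz).symm
        have := Finset.card_le_card hsub
        rw [Finset.card_erase_of_mem (by simpa using hc.mid.adj.2.2.symm),
          card_neighborFinset_eq_degree, card_neighborFinset_eq_degree] at this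
        omega
      have hcard := hc.card_edgeFinset_add_six_le hle hwx (hws p) (hws q)
      have hb := ih H hH (hc.not_circ_of_claw hcol hwx hwn hu (by
        intro a b ha hb hab
        simp only [Set.mem_insert_iff, Set.mem_singleton_iff, not_or] at ha hb
        refine hcrit a b ((contractPath_adj_of_notMem (by simp [ha]) (by simp [hb])).2 hab) ?_ ?_ <;>
          simp [ha, hb])) (by omega)
      have hsub : G.support ⊆ H.support ∪ {u₁, u₃, w} := by
        intro y hy
        by_contra hn
        simp only [Set.mem_union, Set.mem_insert_iff, Set.mem_singleton_iff, not_or] at hn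
        exact hn.1 (hc.mem_support_of_mem hcrit hy hn.2.1 hn.2.2.1 hn.2.2.2)
      have h1 := (Set.ncard_le_ncard hsub).trans (Set.ncard_union_le _ _)
      have h2 := Set.ncard_insert_le u₁ {u₃, w}
      have h3 := Set.ncard_insert_le u₃ {w}
      rw [Set.ncard_singleton] at h3
      -- Three vertices and six edges are lost: 17·3 + 8 ≤ 10·6, so even K_4 is harmless here.
      have := hb.1
      omega
    · right
      obtain ⟨y, hy, hyn⟩ : ∃ y ∈ G.neighborFinset w, y ∉ ({u₂, p, q} : Finset V) := by
        by_contra! hall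
        have := (Finset.card_le_card (fun y hy => hall y hy)).trans Finset.card_le_three
        rw [card_neighborFinset_eq_degree] at this
        omega
      simp only [Finset.mem_insert, Finset.mem_singleton, not_or, mem_neighborFinset] at hy hyn
      have hy1 : y ≠ u₁ := by
        rintro rfl
        rcases (hc.left.2.2.2 w).1 hy.symm with h | h | h
        exacts [hw.2.1 h, hc.w_ne_p h, hwx h]
      have hy3 : y ≠ u₃ := by
        rintro rfl
        rcases (hc.right.2.2.2 w).1 hy.symm with h | h | h
        exacts [hw.2.1 h, hc.w_ne_q h, hwx h]
      have hHwy : H.Adj w y := by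
        refine hcrit w y ((contractPath_adj_of_notMem hc.w_notMem
          (by simp [hy1, hy3, hyn])).2 hy) ?_ ?_ <;>
          simp [hyn, hc.w_ne_p, hc.w_ne_q]
      have hdw := hH.three_le_degree hHwy
      refine ⟨hwx, ?_⟩
      -- In `H` degrees are still at least 3, though `w` has lost two neighbours, and the end of the
      -- missing edge has lost two and gained only `u₂`.
      rcases hmiss with hm | hm
      · refine ⟨five_le_degree_of_reduced (H := H) (u₂ := u₂) (p := p) (fun z hz => ?_)
          hc.mid.adj.2.2.symm hwp (Ne.symm hp.2.1) hdw, Or.inl ?_⟩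
        · exact ⟨(hwH z hz).1, (hwH z hz).2, fun h => hm (h ▸ hz)⟩
        · refine four_le_degree_of_reduced (H := H) (u₂ := u₂) (fun z hz => ?_)
            hc.left.adj.2.1.symm hwp.symm (Ne.symm hw.1)
            (hH.three_le_degree (hu p (by simp)).symm)
          rcases hoff p z hp.2.1 hz with h | h
          · exact Or.inl h
          · exact Or.inr ⟨h.1, h.2.1, fun h' => hm (h' ▸ hz.symm)⟩
      · refine ⟨five_le_degree_of_reduced (H := H) (u₂ := u₂) (p := q) (fun z hz => ?_)
          hc.mid.adj.2.2.symm hwq (Ne.symm hq.2.1) hdw, Or.inr ?_⟩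
        · exact ⟨(hwH z hz).1, (hwH z hz).2, fun h => hm (h ▸ hz)⟩
        · refine four_le_degree_of_reduced (H := H) (u₂ := u₂) (fun z hz => ?_)
            hc.right.adj.2.1.symm hwq.symm (Ne.symm hw.2.2)
            (hH.three_le_degree (hu q (by simp)).symm)
          rcases hoff q z hq.2.1 hz with h | h
          · exact Or.inl h
          · exact Or.inr ⟨h.1, h.2.2.2, fun h' => hm (h' ▸ hz.symm)⟩

end Reduction
end SimpleGraph

namespace SimpleGraph
-- Discharging
section Discharging
open scoped Classical

variable {V : Type*} [Fintype V] {G : SimpleGraph V}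

/-- The neighbours of degree three. -/
noncomputable def lowNbrs (G : SimpleGraph V) (v : V) : Finset V :=
  (G.neighborFinset v).filter fun u => G.degree u = 3

/-- The charge that `z` sends to each neighbour of degree three. -/
noncomputable def charge (G : SimpleGraph V) (z : V) : ℚ :=
  if 4 ≤ G.degree z then (G.degree z - 17 / 5) / (G.lowNbrs z).card else 0

lemma mem_lowNbrs {v u : V} : u ∈ G.lowNbrs v ↔ G.Adj v u ∧ G.degree u = 3 := by
  simp [lowNbrs]

lemma charge_nonneg (z : V) : 0 ≤ G.charge z := by
  unfold charge
  split_ifs with h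
  · have : (4 : ℚ) ≤ G.degree z := by exact_mod_cast h
    exact div_nonneg (by linarith) (by positivity)
  · exact le_rfl

lemma charge_mul_card_le (z : V) :
    G.charge z * (G.lowNbrs z).card ≤ if 4 ≤ G.degree z then (G.degree z : ℚ) - 17 / 5 else 0 := by
  unfold charge
  split_ifs with h
  · have h4 : (4 : ℚ) ≤ G.degree z := by exact_mod_cast h
    rcases Nat.eq_zero_or_pos (G.lowNbrs z).card with h0 | h0
    · rw [h0]
      norm_num
      linarith
    · rw [div_mul_cancel₀ _ (by positivity)]
  · simp

/-- `S` holds neighbours that receive nothing. Since `c ≤ 1`, the inequality at degree `m` persists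
at larger degrees. -/
lemma le_charge {z v : V} {S : Finset V} {m : ℕ} {c : ℚ} (hv : v ∈ G.lowNbrs z)
    (hS : ∀ y ∈ S, G.Adj z y ∧ G.degree y ≠ 3) (hm4 : 4 ≤ m) (hm : m ≤ G.degree z) (hc1 : c ≤ 1)
    (hc : c * (m - S.card) ≤ m - 17 / 5) : c ≤ G.charge z := by
  have hle : (G.lowNbrs z).card + S.card ≤ G.degree z := by
    rw [← Finset.card_union_of_disjoint, ← card_neighborFinset_eq_degree]
    · refine Finset.card_le_card fun y hy => ?_
      rcases Finset.mem_union.1 hy with hy | hy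
      · simpa using (mem_lowNbrs.1 hy).1
      · simpa using (hS y hy).1
    · exact Finset.disjoint_left.2 fun y hy hy' => (hS y hy').2 (mem_lowNbrs.1 hy).2
  have hpos : 0 < (G.lowNbrs z).card := Finset.card_pos.2 ⟨v, hv⟩
  rw [charge, if_pos (hm4.trans hm), le_div_iff₀ (by exact_mod_cast hpos)]
  have h1 : ((G.lowNbrs z).card : ℚ) + S.card ≤ G.degree z := by exact_mod_cast hle
  have h2 : (m : ℚ) ≤ G.degree z := by exact_mod_cast hm
  have h4 : (4 : ℚ) ≤ m := by exact_mod_cast hm4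
  by_cases hc0 : 0 ≤ c
  · nlinarith
  · have : c * ((G.lowNbrs z).card : ℚ) ≤ 0 :=
      mul_nonpos_of_nonpos_of_nonneg (le_of_not_ge hc0) (by positivity)
    linarith

/-- Discharging: if every vertex of degree three ends up with charge at least `2 / 5`, then the
average degree over the nonisolated vertices is at least `17 / 5`. -/
lemma bound_of_discharging (hdeg : ∀ v ∈ G.support, 3 ≤ G.degree v) (t : V → V → ℚ)
    (ht : ∀ u v, t u v ≠ 0 → G.Adj u v ∧ G.degree u = 3 ∧ G.degree v = 3)
    (h : ∀ v, G.degree v = 3 →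
      2 / 5 ≤ ∑ z ∈ G.neighborFinset v, (G.charge z + (t z v - t v z))) :
    17 * G.support.ncard ≤ 10 * G.edgeFinset.card := by
  set L := Finset.univ.filter fun v => G.degree v = 3 with hL
  have h1 : ∑ v ∈ L, ∑ z ∈ G.neighborFinset v, (t z v - t v z) = 0 := by
    have e1 : ∑ v ∈ L, ∑ z ∈ G.neighborFinset v, (t z v - t v z) = ∑ v, ∑ z, (t z v - t v z) := by
      have hzero : ∀ u v, ¬ (G.Adj u v ∧ G.degree u = 3 ∧ G.degree v = 3) → t u v = 0 :=
        fun u v huv => by_contra fun h => huv (ht u v h)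
      rw [hL, Finset.sum_filter]
      refine Finset.sum_congr rfl fun v _ => ?_
      split_ifs with hv
      · refine Finset.sum_subset (Finset.subset_univ _) fun z _ hz => ?_
        rw [mem_neighborFinset] at hz
        rw [hzero z v fun h => hz h.1.symm, hzero v z fun h => hz h.1, sub_zero]
      · refine (Finset.sum_eq_zero fun z _ => ?_).symm
        rw [hzero z v fun h => hv h.2.2, hzero v z fun h => hv h.2.1, sub_zero]
    rw [e1]
    simp only [Finset.sum_sub_distrib]
    rw [Finset.sum_comm, sub_self]
  have h2 : ∑ v ∈ L, ∑ z ∈ G.neighborFinset v, G.charge z =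
      ∑ z, G.charge z * (G.lowNbrs z).card := by
    have e1 : ∀ v, ∑ z ∈ G.neighborFinset v, G.charge z =
        ∑ z, if G.Adj v z then G.charge z else 0 := by
      intro v
      rw [← Finset.sum_filter]
      congr 1
      ext
      simp
    simp only [e1]
    rw [Finset.sum_comm]
    refine Finset.sum_congr rfl fun z _ => ?_
    rw [← Finset.sum_filter, Finset.sum_const, nsmul_eq_mul, mul_comm]
    congr 3
    ext v
    simp [hL, mem_lowNbrs, adj_comm, and_comm]
  have h3 : (2 / 5 : ℚ) * L.card ≤ ∑ z, if 4 ≤ G.degree z then (G.degree z : ℚ) - 17 / 5 else 0 := by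
    calc (2 / 5 : ℚ) * L.card = ∑ v ∈ L, (2 / 5 : ℚ) := by
          rw [Finset.sum_const, nsmul_eq_mul, mul_comm]
      _ ≤ ∑ v ∈ L, ∑ z ∈ G.neighborFinset v, (G.charge z + (t z v - t v z)) :=
          Finset.sum_le_sum fun v hv => h v (by simpa [hL] using hv)
      _ = ∑ z, G.charge z * (G.lowNbrs z).card := by
          simp only [Finset.sum_add_distrib]
          rw [h1, h2, add_zero]
      _ ≤ _ := Finset.sum_le_sum fun z _ => charge_mul_card_le z
  have h4 : (G.support.ncard : ℚ) = ∑ v, if v ∈ G.support then (1 : ℚ) else 0 := by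
    rw [Set.ncard_eq_toFinset_card', Finset.sum_boole]
    congr 2
    ext
    simp
  have h5 : (2 : ℚ) * G.edgeFinset.card = ∑ v, (G.degree v : ℚ) := by
    exact_mod_cast G.sum_degrees_eq_twice_card_edges.symm
  have h6 : (L.card : ℚ) = ∑ v, if G.degree v = 3 then (1 : ℚ) else 0 := by
    rw [hL, Finset.sum_boole]
  -- At degree three the deficit 3 - 17/5 is cancelled by the term 2/5.
  have h7 : ∀ v, (if 4 ≤ G.degree v then (G.degree v : ℚ) - 17 / 5 else 0) =
      G.degree v - 17 / 5 * (if v ∈ G.support then (1 : ℚ) else 0) +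
        2 / 5 * (if G.degree v = 3 then (1 : ℚ) else 0) := by
    intro v
    by_cases hv : v ∈ G.support
    · rcases (hdeg v hv).eq_or_lt with hd | hd
      · rw [← hd]
        simp [hv]
        norm_num
      · rw [if_pos (show 4 ≤ G.degree v from hd), if_pos hv, if_neg (by omega)]
        ring
    · have hd : G.degree v = 0 := by
        rw [← card_neighborFinset_eq_degree, Finset.card_eq_zero, Finset.eq_empty_iff_forall_notMem]
        intro y hy
        exact hv ⟨y, by simpa using hy⟩
      rw [hd]
      simp [hv]
  rw [Finset.sum_congr rfl fun v _ => h7 v, Finset.sum_add_distrib, Finset.sum_sub_distrib,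
    ← Finset.mul_sum, ← Finset.mul_sum, ← h4, ← h5, ← h6] at h3
  have : (17 : ℚ) * G.support.ncard ≤ 10 * G.edgeFinset.card := by linarith
  exact_mod_cast this

lemma HasNbrs.sum_eq {v a b c : V} (h : G.HasNbrs v a b c) (F : V → ℚ) :
    ∑ z ∈ G.neighborFinset v, F z = F a + F b + F c := by
  have : G.neighborFinset v = {a, b, c} := by
    ext y
    simp [h.2.2.2]
  rw [this, Finset.sum_insert (by simp [h.1, h.2.1]), Finset.sum_pair h.2.2.1, add_assoc]

/-- `u` has degree three and is the only neighbour of degree three of each of its neighbours of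
degree three. -/
def IsGiver (G : SimpleGraph V) (u : V) : Prop :=
  G.degree u = 3 ∧ ∀ y ∈ G.lowNbrs u, ∀ y' ∈ G.lowNbrs y, y' = u

/-- Additional charge sent from `u` to `v`. -/
noncomputable def transfer (G : SimpleGraph V) (u v : V) : ℚ :=
  if G.IsGiver u ∧ v ∈ G.lowNbrs u then 1 / 20 else 0

lemma transfer_nonneg (u v : V) : 0 ≤ G.transfer u v := by
  unfold transfer
  split_ifs <;> norm_num

lemma transfer_le (u v : V) : G.transfer u v ≤ 1 / 20 := by
  unfold transfer
  split_ifs <;> norm_num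

lemma transfer_eq_zero_of_degree_ne {u v : V} (h : G.degree v ≠ 3) : G.transfer u v = 0 := by
  unfold transfer
  rw [if_neg]
  rintro ⟨-, h'⟩
  exact h (mem_lowNbrs.1 h').2

lemma transfer_eq_zero_of_not_isGiver {u v : V} (h : ¬ G.IsGiver u) : G.transfer u v = 0 := by
  unfold transfer
  rw [if_neg fun h' => h h'.1]

/-- The structure around vertices with two neighbours of degree three that remains after all
reductions. -/
def CenterCondition (G : SimpleGraph V) : Prop :=
  ∀ ⦃u₁ v u₃⦄, u₁ ≠ u₃ → G.degree v = 3 → u₁ ∈ G.lowNbrs v → u₃ ∈ G.lowNbrs v →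
    ∃ w p q x, G.IsCenter u₁ v u₃ w p q x ∧ w ≠ x ∧ 5 ≤ G.degree w ∧
      (4 ≤ G.degree p ∨ 4 ≤ G.degree q)

/-- Each neighbour gives at least (4 - 17/5)/4 = 3/20, in total 9/20. -/
lemma EdgeCritical.final_charge_no_low (hG : G.EdgeCritical) {v : V} (hv : G.degree v = 3)
    (hlow : G.lowNbrs v = ∅) :
    2 / 5 ≤ ∑ z ∈ G.neighborFinset v, (G.charge z + (G.transfer z v - G.transfer v z)) := by
  have hz : ∀ z ∈ G.neighborFinset v,
      3 / 20 ≤ G.charge z + (G.transfer z v - G.transfer v z) := by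
    intro z hz
    rw [mem_neighborFinset] at hz
    have hz3 : G.degree z ≠ 3 := fun h => by
      have := mem_lowNbrs.2 ⟨hz, h⟩
      simp [hlow] at this
    have hz4 : 4 ≤ G.degree z := by
      have := hG.three_le_degree hz.symm
      omega
    have h1 := transfer_nonneg (G := G) z v
    have h2 := transfer_eq_zero_of_degree_ne (u := v) hz3
    have h3 : 3 / 20 ≤ G.charge z := le_charge (S := ∅) (m := 4) (mem_lowNbrs.2 ⟨hz.symm, hv⟩)
      (by simp) le_rfl hz4 (by norm_num) (by norm_num)
    linarith
  have := Finset.card_nsmul_le_sum _ _ _ hz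
  rw [card_neighborFinset_eq_degree, hv] at this
  norm_num at this ⊢
  linarith

lemma EdgeCritical.final_charge_one_low (hG : G.EdgeCritical) (hcol : ¬ G.CircularColorable 7 2)
    (hcen : G.CenterCondition) {v u : V} (hv : G.degree v = 3) (hlow : G.lowNbrs v = {u}) :
    2 / 5 ≤ ∑ z ∈ G.neighborFinset v, (G.charge z + (G.transfer z v - G.transfer v z)) := by
  have hu := mem_lowNbrs.1 (show u ∈ G.lowNbrs v by simp [hlow])
  have hvu : v ∈ G.lowNbrs u := mem_lowNbrs.2 ⟨hu.1.symm, hv⟩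
  have hhigh : ∀ z, G.Adj v z → z ≠ u → 4 ≤ G.degree z := by
    intro z hz hzu
    have h3 := hG.three_le_degree hz.symm
    by_contra! h4
    have := mem_lowNbrs.2 ⟨hz, show G.degree z = 3 by omega⟩
    rw [hlow, Finset.mem_singleton] at this
    exact hzu this
  by_cases hex : ∃ v' ∈ G.lowNbrs u, v' ≠ v
  · obtain ⟨v', hv', hne⟩ := hex
    obtain ⟨w, p, q, x, hc, hwx, hw, -⟩ := hcen hne.symm hu.2 hvu hv'
    have hp4 := hhigh p hc.left.adj.2.1 hc.left.1.symm
    have hx4 := hhigh x hc.left.adj.2.2 hc.left.2.1.symm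
    have hng : ¬ G.IsGiver v := fun hg =>
      hne (hg.2 u (by simp [hlow]) v' hv')
    -- The neighbour `w` of `p` has degree at least 5, so at degree 4 the excess 3/5 is split at
    -- most three ways.
    have hp : 1 / 5 ≤ G.charge p := le_charge (S := {w}) (m := 4)
      (mem_lowNbrs.2 ⟨hc.left.adj.2.1.symm, hv⟩)
      (by simpa using ⟨(hc.adj_w hwx).1.symm, by omega⟩) le_rfl hp4 (by norm_num) (by norm_num)
    rw [hc.left.sum_eq]
    simp only [transfer_eq_zero_of_not_isGiver hng]
    have t1 := transfer_nonneg (G := G) u v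
    have t2 := transfer_nonneg (G := G) p v
    have t3 := transfer_nonneg (G := G) x v
    have c1 := charge_nonneg (G := G) u
    by_cases hex' : ∃ v'' ∈ G.lowNbrs v', v'' ≠ u
    · obtain ⟨v'', hv'', hne'⟩ := hex'
      obtain ⟨hv'1, hv'2⟩ := mem_lowNbrs.1 hv'
      obtain ⟨W, P, Q, X, hc', -, hW, -⟩ := hcen hne'.symm hv'2
        (mem_lowNbrs.2 ⟨hv'1.symm, hu.2⟩) hv''
      -- Here `v'` is itself the middle of such a path, so its third neighbour `x` has degree at
      -- least 5 and gives 8/25.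
      have hxW : x = W := by
        rcases (hc'.mid.2.2.2 x).1 hc.right.adj.2.2 with h | h | h
        · exact absurd h hc.right.2.1.symm
        · have := (mem_lowNbrs.1 hv'').2
          rw [← h] at this
          omega
        · exact h
      have hx : 8 / 25 ≤ G.charge x := le_charge (S := ∅) (m := 5)
        (mem_lowNbrs.2 ⟨hc.left.adj.2.2.symm, hv⟩) (by simp) (by norm_num) (hxW ▸ hW)
        (by norm_num) (by norm_num)
      linarith
    · push Not at hex'
      have hx : 3 / 20 ≤ G.charge x := le_charge (S := ∅) (m := 4)
        (mem_lowNbrs.2 ⟨hc.left.adj.2.2.symm, hv⟩) (by simp) (by norm_num) hx4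
        (by norm_num) (by norm_num)
      -- The tight case: 1/5 from `p`, 3/20 from `x` and 1/20 from `u` make exactly 2/5.
      have hg : G.IsGiver u := by
        refine ⟨hu.2, fun y hy y' hy' => ?_⟩
        rcases (hc.mid.2.2.2 y).1 (mem_lowNbrs.1 hy).1 with rfl | rfl | rfl
        · simpa [hlow] using hy'
        · exact hex' y' hy'
        · have := (mem_lowNbrs.1 hy).2
          omega
      have ht : G.transfer u v = 1 / 20 := by
        rw [transfer, if_pos ⟨hg, hvu⟩]
      linarith
  · push Not at hex
    obtain ⟨y₁, z₁, h1⟩ := exists_hasNbrs hv hu.1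
    obtain ⟨y₂, z₂, h2⟩ := exists_hasNbrs hu.2 hu.1.symm
    have hhigh' : ∀ z, G.Adj u z → z ≠ v → G.degree z ≠ 3 := fun z hz hzv h3 =>
      hzv (hex z (mem_lowNbrs.2 ⟨hz, h3⟩))
    have hy14 := hhigh y₁ h1.adj.2.1 h1.1.symm
    have hz14 := hhigh z₁ h1.adj.2.2 h1.2.1.symm
    have hy2 := hhigh' y₂ h2.adj.2.1 h2.1.symm
    have hz2 := hhigh' z₂ h2.adj.2.2 h2.2.1.symm
    -- `u` and `v` form an isolated edge among the vertices of degree three. Each outer neighbour of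
    -- `v` has a neighbour of larger degree, so both give 1/5, and the transfers between `u` and `v`
    -- cancel.
    have key : ∀ a b, G.HasNbrs v u a b → 1 / 5 ≤ G.charge a := by
      intro a b hab
      obtain ⟨c, hc, hc3⟩ : ∃ c, G.Adj a c ∧ G.degree c ≠ 3 := by
        rcases hG.adj_of_edge hcol hab h2 with h | h | h
        · have := hhigh b hab.adj.2.2 hab.2.1.symm
          exact ⟨b, h, by omega⟩
        · exact ⟨y₂, h, hy2⟩
        · exact ⟨z₂, h, hz2⟩
      exact le_charge (S := {c}) (m := 4) (mem_lowNbrs.2 ⟨hab.adj.2.1.symm, hv⟩)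
        (by simpa using ⟨hc, hc3⟩) le_rfl (hhigh a hab.adj.2.1 hab.1.symm)
        (by norm_num) (by norm_num)
    have hg : G.IsGiver u := by
      refine ⟨hu.2, fun y hy y' hy' => ?_⟩
      rw [hex y hy, hlow] at hy'
      simpa using hy'
    have ht : G.transfer u v = 1 / 20 := by
      rw [transfer, if_pos ⟨hg, hvu⟩]
    rw [h1.sum_eq, transfer_eq_zero_of_degree_ne (u := v) (v := y₁) (by omega),
      transfer_eq_zero_of_degree_ne (u := v) (v := z₁) (by omega)]
    have t1 := transfer_le (G := G) v u
    have t2 := transfer_nonneg (G := G) y₁ v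
    have t3 := transfer_nonneg (G := G) z₁ v
    have c1 := charge_nonneg (G := G) u
    have c2 := key y₁ z₁ h1
    have c3 := key z₁ y₁ h1.swap
    linarith

lemma CenterCondition.final_charge_two_low (hcen : G.CenterCondition) {v u₁ u₃ : V}
    (hv : G.degree v = 3) (h1 : u₁ ∈ G.lowNbrs v) (h3 : u₃ ∈ G.lowNbrs v) (hne : u₁ ≠ u₃) :
    2 / 5 ≤ ∑ z ∈ G.neighborFinset v, (G.charge z + (G.transfer z v - G.transfer v z)) := by
  obtain ⟨w, p, q, x, hc, hwx, hw, hpq⟩ := hcen hne hv h1 h3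
  obtain ⟨hwp, hwq⟩ := hc.adj_w hwx
  have hvw : v ∈ G.lowNbrs w := mem_lowNbrs.2 ⟨hc.mid.adj.2.2.symm, hv⟩
  rw [hc.mid.sum_eq, transfer_eq_zero_of_degree_ne (u := v) (v := w) (by omega)]
  have t1 := transfer_nonneg (G := G) u₁ v
  have t2 := transfer_nonneg (G := G) u₃ v
  have t3 := transfer_nonneg (G := G) w v
  have c1 := charge_nonneg (G := G) u₁
  have c2 := charge_nonneg (G := G) u₃
  by_cases hg : G.IsGiver v
  · have hp3 : G.degree p ≠ 3 := fun h =>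
      hc.left.1 (hg.2 u₁ h1 p (mem_lowNbrs.2 ⟨hc.left.adj.2.1, h⟩)).symm
    have hq3 : G.degree q ≠ 3 := fun h =>
      hc.right.1 (hg.2 u₃ h3 q (mem_lowNbrs.2 ⟨hc.right.adj.2.1, h⟩)).symm
    -- Neither `p` nor `q` shares in the excess 8/5 of `w`; after paying at most 2/20, `v` keeps at
    -- least 13/30.
    have hcw : 8 / 15 ≤ G.charge w := le_charge (S := {p, q}) (m := 5) hvw
      (by simpa using ⟨⟨hwp, hp3⟩, hwq, hq3⟩) (by norm_num) hw (by norm_num)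
      (by rw [Finset.card_pair hc.p_ne_q]; norm_num)
    have t4 := transfer_le (G := G) v u₁
    have t5 := transfer_le (G := G) v u₃
    linarith
  · rw [transfer_eq_zero_of_not_isGiver hg, transfer_eq_zero_of_not_isGiver hg]
    obtain ⟨y, hy, hy3⟩ : ∃ y, G.Adj w y ∧ G.degree y ≠ 3 := by
      rcases hpq with h | h
      · exact ⟨p, hwp, by omega⟩
      · exact ⟨q, hwq, by omega⟩
    -- One neighbour outside the sharing suffices: (5 - 17/5)/4 = 2/5.
    have hcw : 2 / 5 ≤ G.charge w := le_charge (S := {y}) (m := 5) hvw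
      (by simpa using ⟨hy, hy3⟩) (by norm_num) hw (by norm_num) (by norm_num)
    linarith

lemma EdgeCritical.bound_of_centerCondition (hG : G.EdgeCritical)
    (hcol : ¬ G.CircularColorable 7 2) (hcen : G.CenterCondition) :
    17 * G.support.ncard ≤ 10 * G.edgeFinset.card := by
  refine bound_of_discharging (fun v ⟨y, hy⟩ => hG.three_le_degree hy) G.transfer ?_ ?_
  · intro u v huv
    unfold transfer at huv
    have := (ite_ne_right_iff.1 huv).1
    obtain ⟨h1, h2⟩ := this
    exact ⟨(mem_lowNbrs.1 h2).1, h1.1, (mem_lowNbrs.1 h2).2⟩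
  · intro v hv
    rcases Nat.lt_trichotomy (G.lowNbrs v).card 1 with h | h | h
    · exact hG.final_charge_no_low hv (Finset.card_eq_zero.1 (by omega))
    · obtain ⟨u, hu⟩ := Finset.card_eq_one.1 h
      exact hG.final_charge_one_low hcol hcen hv hu
    · obtain ⟨u₁, h1, u₃, h3, hne⟩ := Finset.one_lt_card.1 h
      exact hcen.final_charge_two_low hv h1 h3 hne

end Discharging
end SimpleGraph

namespace SimpleGraph
-- Induction and transfer to 4-critical graphs
section Main
open scoped Classical

variable {V : Type*} {G : SimpleGraph V}

lemma EdgeCritical.edgeBound [Fintype V] (hG : G.EdgeCritical)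
    (hcol : ¬ G.CircularColorable 7 2) : G.EdgeBound := by
  induction hn : G.edgeFinset.card using Nat.strong_induction_on generalizing G with
  | _ n ih =>
  by_cases h4 : (⊤ : SimpleGraph (Fin 4)) ⊑ G
  · exact hG.edgeBound_of_top_four h4
  by_cases h6 : wheelGraph 6 ⊑ G
  · exact hG.edgeBound_of_wheelGraph_six h6
  suffices h : 17 * G.support.ncard ≤ 10 * G.edgeFinset.card from
    ⟨by omega, fun _ => by omega, fun _ _ => h⟩
  -- If the bound fails, no reduction can yield it, so every center has the large degrees that
  -- discharging needs.
  by_contra hb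
  refine hb (hG.bound_of_centerCondition hcol ?_)
  intro u₁ v u₃ hne hv h1 h3
  obtain ⟨h1, hd1⟩ := mem_lowNbrs.1 h1
  obtain ⟨h3, hd3⟩ := mem_lowNbrs.1 h3
  obtain ⟨w, hmid⟩ := exists_hasNbrs_of_two hv h1 h3 hne
  by_cases hadj : G.Adj u₁ u₃
  · obtain ⟨z₁, hz1⟩ := exists_hasNbrs_of_two hd1 h1.symm hadj h3.ne
    obtain ⟨z₃, hz3⟩ := exists_hasNbrs_of_two hd3 hadj.symm h3.symm h1.ne'
    obtain ⟨rfl, rfl⟩ := hG.eq_of_triangle hcol hz1 hmid hz3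
    exact absurd (top_four_isContained h1.symm hadj hz1.adj.2.2 h3 hmid.adj.2.2 hz3.adj.2.2) h4
  · obtain ⟨s, t, hs⟩ := exists_hasNbrs hd1 h1.symm
    obtain ⟨s', t', hs'⟩ := exists_hasNbrs hd3 h3.symm
    obtain ⟨p, q, x, hl, hr, hpq, hw⟩ := hG.center_structure hcol hs hs' hmid hadj
    have hc : G.IsCenter u₁ v u₃ w p q x := ⟨hl, hr, hmid, hadj, hpq, hw⟩
    exact ⟨w, p, q, x, hc, (hc.edgeBound_or hG hcol h6
      fun H hH hHcol hlt => ih _ (hn ▸ hlt) hH hHcol rfl).resolve_left hb⟩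

lemma EdgeCritical.nonempty_iso_of_copy {W : Type*} {A : SimpleGraph W} (hG : G.EdgeCritical)
    (hsupp : G.support = Set.univ) (hA : ¬ A.Colorable 3) (f : Copy A G) : Nonempty (G ≃g A) := by
  have hinj : Function.Injective f := f.injective
  have hsurj : Function.Surjective f := by
    intro a
    obtain ⟨b, hab⟩ : a ∈ G.support := by simp [hsupp]
    obtain ⟨i, -, -, h, -⟩ := hG.copy_surj hA f hab
    exact ⟨i, h⟩
  refine ⟨Iso.symm ⟨Equiv.ofBijective f ⟨hinj, hsurj⟩, ?_⟩⟩
  intro a b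
  change G.Adj (f a) (f b) ↔ A.Adj a b
  refine ⟨fun h => ?_, fun h => f.toHom.map_adj h⟩
  obtain ⟨i, j, hij, hi, hj⟩ := hG.copy_surj hA f h
  rwa [← hinj hi, ← hinj hj]

lemma IsKCritical.not_colorable_three (h : G.IsKCritical 4) : ¬ G.Colorable 3 := by
  intro h3
  have := chromaticNumber_le_iff_colorable.2 h3
  rw [h.1] at this
  norm_num at this

lemma IsKCritical.edgeCritical (h : G.IsKCritical 4) : G.EdgeCritical := by
  refine ⟨h.not_colorable_three, fun H hle hH => ?_⟩
  by_contra hne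
  have htop : toSubgraph H hle ≠ ⊤ := by
    intro htop
    apply hne
    ext a b
    have := congrArg (fun S : G.Subgraph => S.Adj a b) htop
    simpa using this
  obtain ⟨φ⟩ := h.2 _ htop
  exact hH ⟨⟨fun v => φ ⟨v, trivial⟩, fun {a b} hab => φ.valid hab⟩⟩

lemma IsKCritical.support_eq_univ (h : G.IsKCritical 4) : G.support = Set.univ := by
  rw [Set.eq_univ_iff_forall]
  intro v
  by_contra hv
  have hadj : ∀ y, ¬ G.Adj v y := fun y hy => hv ⟨y, hy⟩
  have htop : (⊤ : G.Subgraph).deleteVerts {v} ≠ ⊤ := by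
    intro htop
    have : v ∈ ((⊤ : G.Subgraph).deleteVerts {v}).verts := by
      rw [htop]
      trivial
    simp at this
  obtain ⟨φ⟩ := h.2 _ htop
  refine h.not_colorable_three
    ⟨⟨fun y => if hy : y = v then 0 else φ ⟨y, by simp [hy]⟩, fun {a b} hab => ?_⟩⟩
  have ha : a ≠ v := by rintro rfl; exact hadj b hab
  have hb : b ≠ v := by rintro rfl; exact hadj a hab.symm
  simp only [ha, hb, dite_false]
  exact φ.valid (by simpa [ha, hb] using hab)

end Main
end SimpleGraph

theorem theorem1p7 {V : Type*} [Fintype V] [DecidableEq V] (G : SimpleGraph V)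
    [DecidableRel G.Adj]
    (hcrit : G.IsKCritical 4)
    (hcol : ¬ G.CircularColorable 7 2)
    (hK4 : ¬ Nonempty (G ≃g (⊤ : SimpleGraph (Fin 4))))
    (hW6 : ¬ Nonempty (G ≃g wheelGraph 6)) :
    (17 * (Fintype.card V : ℝ)) / 10 ≤ (G.edgeFinset.card : ℝ) := by
  have hG := hcrit.edgeCritical
  have hs := hcrit.support_eq_univ
  have hb := (hG.edgeBound hcol).2.2
    (fun ⟨f⟩ => hK4 (hG.nonempty_iso_of_copy hs SimpleGraph.not_colorable_top_four f))
    (fun ⟨f⟩ => hW6 (hG.nonempty_iso_of_copy hs SimpleGraph.not_colorable_wheelGraph_six f))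
  rw [hs, Set.ncard_univ, Nat.card_eq_fintype_card] at hb
  have hb' : 17 * Fintype.card V ≤ 10 * G.edgeFinset.card := by convert hb
  have : (17 : ℝ) * Fintype.card V ≤ 10 * G.edgeFinset.card := by exact_mod_cast hb'
  linarith
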